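/- Let $\mathbb E^4_2$ be $\mathbb R^4$ with $\langle x,y\rangle=x_1y_1+x_2y_2-x_3y_3-x_4y_4$. Let $D\subseteq\mathbb R^2$ be open and let $z:D\to\mathbb E^4_2$ be a smooth parametrized Lorentz surface (its induced metric $g$ has signature $(1,1)$) which is flat (Gaussian curvature $0$) and quasi-minimal (its mean curvature vector $H$ satisfies $H\neq0$ and $\langle H,H\rangle=0$ at each point). Let $G=|\det g|^{-1/2}\,\partial_1z\wedge\partial_2z\in\Lambda^2\mathbb E^4_2$ be its Gauss map and $\Delta=-\operatorname{tr}\operatorname{Hess}$ its Laplacian. For an open $U\subseteq D$, the surface has *pointwise 1-type Gauss map on $U$* if $\Delta G=\phi\,(G+C)$ on $U$ for some smooth nowhere vanishing $\phi:U\to\mathbb R$ and some constant $C\in\Lambda^2\mathbb E^4_2$. For a smooth function $\theta$ on an open set $V\subseteq\mathbb R^2$ put $$z_\theta(u,v)=\Bigl(\theta(u,v),\tfrac{u-v}{\sqrt2},\tfrac{u+v}{\sqrt2},\theta(u,v)\Bigr),\qquad (u,v)\in V .$$ The part of the surface over an open set $U\subseteq D$ is *congruent to $z_\theta$* if $z\circ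 h=A z_\theta+w$ on $V$ for some diffeomorphism $h:V\to U$, some linear isometry $A$ of $\mathbb E^4_2$ and some $w\in\mathbb E^4_2$. Consider the condition $$(*)\qquad \frac{\partial^2\theta}{\partial u\,\partial v}=F\circ\psi\ \text{ on } V,\qquad \psi(u,v)=\theta(u,v)+c_1u+c_2v,$$ where $c_1,c_2$ are real constants and $F$ is a smooth real function on an open set of reals containing $\psi(V)$, not constant on $\psi(V)$. 1. If the surface has pointwise 1-type Gauss map on a neighbourhood of $p\in D$, then its part over some neighbourhood of $p$ is congruent to $z_\theta$ for some smooth $\theta$. 2. Let $p\in D$ with $\Delta G(p)\neq0$. Then the surface has pointwise 1-type Gauss map on some neighbourhood of $p$ if and only if its part over some neighbourhood of $p$ is congruent to $z_\theta$ for some $\theta$ satisfying $(*)$ for some $F,c_1,c_2$. 3. Let $\theta$ satisfy $(*)$ and let the part of the surface over an open set $U\subseteq D$ be congruent to $z_\theta$ through $h$, $A$, $w$, where the Jacobian determinant of $h$ has the constant sign $\sigma\in\{1,-1\}$. Put $\eta_0=(1,0,0,1)$, $\eta_1=(0,\frac1{\sqrt2},\frac1{\sqrt2},0)$, $\eta_2=(0,-\frac1{\sqrt2},\frac1{\sqrt2},0)$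 and $$C_0=c_1\,\eta_0\wedge\eta_2-c_2\,\eta_0\wedge\eta_1-\eta_1\wedge\eta_2 .$$ Then $C_0\neq0$ and $\Delta G=\phi\,(G+C)$ on $U$ for the smooth function $\phi=2\,(F'\circ\psi)\circ h^{-1}$ and the constant bivector $C=\sigma\,(\Lambda^2A)\,C_0$. In particular, if $F'$ has no zero on $\psi(V)$, then the surface has pointwise 1-type Gauss map on $U$. -/

import Mathlib

open scoped ContDiff

noncomputable section

namespace FlatQuasi

/-- The vector space underlying the pseudo-Euclidean space `𝔼⁴₂`. Its Euclidean norm is used only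
for the topology and for derivatives. -/
abbrev E := EuclideanSpace ℝ (Fin 4)

/-- The space of bivectors `Λ² 𝔼⁴₂`, in which the Gauss map of a surface takes its values. -/
abbrev Biv := ⋀[ℝ]^2 E

/-- The parameter plane. -/
abbrev Plane := ℝ × ℝ

/-- The neutral scalar product `dx₁² + dx₂² - dx₃² - dx₄²` of `𝔼⁴₂`. -/
def ip (x y : E) : ℝ := x 0 * y 0 + x 1 * y 1 - x 2 * y 2 - x 3 * y 3

/-- The exterior product of two vectors. -/
def wedge (x y : E) : Biv := exteriorPower.ιMulti ℝ 2 ![x, y]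

section Calculus

variable {W : Type*} [NormedAddCommGroup W] [NormedSpace ℝ W]

/-- The partial derivative in the `i`-th parameter: `pd 0 = ∂/∂u`, `pd 1 = ∂/∂v`. -/
def pd (i : Fin 2) (f : Plane → W) (p : Plane) : W :=
  fderiv ℝ f p ((![((1 : ℝ), (0 : ℝ)), ((0 : ℝ), (1 : ℝ))] : Fin 2 → Plane) i)

end Calculus

/-- The matrix `g i j = ⟨∂ᵢ z, ∂ⱼ z⟩` of the induced metric of the parametrized surface `z`. -/
def metric (z : Plane → E) (p : Plane) : Matrix (Fin 2) (Fin 2) ℝ :=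
  Matrix.of fun i j => ip (pd i z p) (pd j z p)

/-- The coefficients of the induced (Levi-Civita) connection, `∇_{∂ᵢ} ∂ⱼ = Σₖ Γᵏᵢⱼ ∂ₖ`: the
components of the tangential part of `∂ᵢ ∂ⱼ z`. The arguments are in the order `k i j`. -/
def christoffel (z : Plane → E) (k i j : Fin 2) (p : Plane) : ℝ :=
  ∑ l, (metric z p)⁻¹ k l * ip (pd i (pd j z) p) (pd l z p)

/-- The second fundamental form `h(∂ᵢ, ∂ⱼ)`: the normal part of `∂ᵢ ∂ⱼ z`. -/
def secondForm (z : Plane → E) (i j : Fin 2) (p : Plane) : E :=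
  pd i (pd j z) p - ∑ k, christoffel z k i j p • pd k z p

/-- The mean curvature vector `H = (1/2) tr h`. -/
def meanCurv (z : Plane → E) (p : Plane) : E :=
  (1 / 2 : ℝ) • ∑ i, ∑ j, (metric z p)⁻¹ i j • secondForm z i j p

/-- The components `Rˡ` of `R(∂ᵢ, ∂ⱼ) ∂ₖ = ∇ᵢ∇ⱼ∂ₖ - ∇ⱼ∇ᵢ∂ₖ = Σₗ Rˡ ∂ₗ`. -/
def riemann (z : Plane → E) (l k i j : Fin 2) (p : Plane) : ℝ :=
  pd i (christoffel z l j k) p - pd j (christoffel z l i k) p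
    + ∑ m, (christoffel z l i m p * christoffel z m j k p
        - christoffel z l j m p * christoffel z m i k p)

/-- The Gaussian curvature `K = ⟨R(∂ᵤ, ∂ᵥ) ∂ᵥ, ∂ᵤ⟩ / det g`. -/
def gaussCurv (z : Plane → E) (p : Plane) : ℝ :=
  (∑ l, metric z p 0 l * riemann z l 1 0 1 p) / (metric z p).det

/-- The Laplace operator of the surface `z`, with the sign convention `Δ = - tr Hess`, i.e.
`Δ f = - Σ gⁱʲ (∂ᵢ ∂ⱼ f - Σₖ Γᵏᵢⱼ ∂ₖ f)`. -/
def laplacian {W : Type*} [NormedAddCommGroup W] [NormedSpace ℝ W]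
    (z : Plane → E) (f : Plane → W) (p : Plane) : W :=
  -∑ i, ∑ j, (metric z p)⁻¹ i j • (pd i (pd j f) p - ∑ k, christoffel z k i j p • pd k f p)

/-- The Gauss map of a Lorentz surface, oriented by its parameters: the unit bivector
`e₁ ∧ e₂` of a positively oriented orthonormal tangent frame. -/
def gaussMap (z : Plane → E) (p : Plane) : Biv :=
  (Real.sqrt (-(metric z p).det))⁻¹ • wedge (pd 0 z p) (pd 1 z p)

/-- `z` restricted to the open set `D` is a smooth Lorentz surface: the induced metric has
signature `(1,1)`, i.e. negative determinant. In particular `z` is an immersion on `D`. -/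
def IsLorentzSurface (z : Plane → E) (D : Set Plane) : Prop :=
  IsOpen D ∧ ContDiffOn ℝ ∞ z D ∧ ∀ p ∈ D, (metric z p).det < 0

/-- The Gaussian curvature vanishes. -/
def IsFlat (z : Plane → E) (D : Set Plane) : Prop :=
  ∀ p ∈ D, gaussCurv z p = 0

/-- The mean curvature vector is lightlike at each point. -/
def IsQuasiMinimal (z : Plane → E) (D : Set Plane) : Prop :=
  ∀ p ∈ D, meanCurv z p ≠ 0 ∧ ip (meanCurv z p) (meanCurv z p) = 0

/-- `Δ G = φ (G + C)` holds on `U`, with `φ` smooth on `U` and `C` a constant bivector. -/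
def GaussMapEq (z : Plane → E) (U : Set Plane) (φ : Plane → ℝ) (C : Biv) : Prop :=
  ContDiffOn ℝ ∞ φ U ∧
    ∀ p ∈ U, laplacian z (gaussMap z) p = φ p • (gaussMap z p + C)

/-- The surface `z` restricted to `U` has pointwise 1-type Gauss map. -/
def HasPointwiseOneType (z : Plane → E) (U : Set Plane) : Prop :=
  ∃ (φ : Plane → ℝ) (C : Biv), GaussMapEq z U φ C ∧ ∀ p ∈ U, φ p ≠ 0

/-- The surface `(u, v) ↦ (θ, (u - v)/√2, (u + v)/√2, θ)`. -/
def model (θ : Plane → ℝ) (q : Plane) : E :=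
  !₂[θ q, (q.1 - q.2) / Real.sqrt 2, (q.1 + q.2) / Real.sqrt 2, θ q]

/-- The function `ψ(u, v) = θ(u, v) + c₁ u + c₂ v`. -/
def psi (θ : Plane → ℝ) (c₁ c₂ : ℝ) (q : Plane) : ℝ := θ q + c₁ * q.1 + c₂ * q.2

/-- On `V` the function `θ` is smooth and satisfies `θ_uv = F ∘ ψ`, where `F` is smooth on an open
set of reals containing the values of `ψ`, and not constant on these values. -/
def ModelCondition (V : Set Plane) (θ : Plane → ℝ) (F : ℝ → ℝ) (c₁ c₂ : ℝ) : Prop :=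
  ContDiffOn ℝ ∞ θ V ∧
  (∃ J : Set ℝ, IsOpen J ∧ Set.MapsTo (psi θ c₁ c₂) V J ∧ ContDiffOn ℝ ∞ F J) ∧
  (∃ q ∈ V, ∃ q' ∈ V, F (psi θ c₁ c₂ q) ≠ F (psi θ c₁ c₂ q')) ∧
  ∀ q ∈ V, pd 0 (pd 1 θ) q = F (psi θ c₁ c₂ q)

/-- The isometry `x ↦ A x + w` of `𝔼⁴₂`, together with the smooth change of parameters `h`, carries
the surface `y` restricted to `h.source` onto the surface `z` restricted to `h.target`. -/
def CongruentVia (y z : Plane → E) (A : E →ₗ[ℝ] E) (w : E)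
    (h : OpenPartialHomeomorph Plane Plane) : Prop :=
  (∀ a b, ip (A a) (A b) = ip a b) ∧
  ContDiffOn ℝ ∞ h h.source ∧ ContDiffOn ℝ ∞ h.symm h.target ∧
  ∀ q ∈ h.source, z (h q) = A (y q) + w

def eta0 : E := !₂[1, 0, 0, 1]

def eta1 : E := !₂[0, 1 / Real.sqrt 2, 1 / Real.sqrt 2, 0]

def eta2 : E := !₂[0, -(1 / Real.sqrt 2), 1 / Real.sqrt 2, 0]

/-- The bivector `c₁ η₀ ∧ η₂ - c₂ η₀ ∧ η₁ - η₁ ∧ η₂`. -/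
def modelC (c₁ c₂ : ℝ) : Biv :=
  c₁ • wedge eta0 eta2 - c₂ • wedge eta0 eta1 - wedge eta1 eta2

end FlatQuasi

end

open scoped ContDiff
open FlatQuasi Set Filter Topology

namespace FlatQuasi

/-! ### The scalar product -/

/-! A flat Lorentz surface has local null coordinates with metric `-2 du dv`
(`exists_null_coordinates`). Write `x` for the surface in these coordinates. The Laplacian becomes
`2 ∂u∂v`, the mean curvature vector is `-n` with `n = x_uv`, and the Gauss map is `σ x_u ∧ x_v`,
where `σ` is the orientation sign (`laplacian_comp`, `meanCurv_comp`, `gaussMap_comp`).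
Quasi-minimality says that `n` is null and nonzero. All second derivatives of `x` are normal, and
`⟨x_uu, x_vv⟩ = 0`.

The crux is `NullParam.uu_n_vv_n`. Pairing the 1-type equation with `n ∧ x_u` and `n ∧ x_v` shows
that `C` is orthogonal to both. Differentiating these relations and using the equation again leaves
an algebraic system whose only solution is `⟨x_uu, n⟩ = ⟨x_vv, n⟩ = 0`. The whole second fundamental
form is then parallel to `n`, and `n` has a constant direction `η`. Two integrations give `x = θ η +
u E₁ + v E₂ + w` (`NullParam.exists_affine`). A Witt-type extension (`exists_isometry`) moves `η,
E₁, E₂` to `η₀, η₁, η₂`, which is the model form.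

For a model surface put `L = θ_uv`. Up to `σ` and `A`, `G` is `θ_u η₀∧η₂ - θ_v η₀∧η₁ + η₁∧η₂` and
`ΔG` is `2 (L_u η₀∧η₂ - L_v η₀∧η₁)`. The 1-type equation therefore gives `dL = (φ/2) dψ` with `ψ = θ
+ c₁ u + c₂ v`, the numbers `c₁, c₂` being components of `C`. Where `ΔG ≠ 0`, also `dψ ≠ 0`, so `L`
is locally a function `F` of `ψ` (`exists_comp_of_pd_eq`). Conversely, the chain rule applied to `L
= F ∘ ψ` gives the equation with `φ = 2 F'(ψ)` (`gaussMapEq_of_congruent`). -/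

theorem ip_comm (x y : E) : ip x y = ip y x := by unfold ip; ring
theorem ip_add_left (x y z : E) : ip (x + y) z = ip x z + ip y z := by
  simp only [ip, PiLp.add_apply]; ring
theorem ip_add_right (x y z : E) : ip x (y + z) = ip x y + ip x z := by
  simp only [ip, PiLp.add_apply]; ring
theorem ip_sub_left (x y z : E) : ip (x - y) z = ip x z - ip y z := by
  simp only [ip, PiLp.sub_apply]; ring
theorem ip_sub_right (x y z : E) : ip x (y - z) = ip x y - ip x z := by
  simp only [ip, PiLp.sub_apply]; ring
theorem ip_smul_left (c : ℝ) (x y : E) : ip (c • x) y = c * ip x y := by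
  simp only [ip, PiLp.smul_apply, smul_eq_mul]; ring
theorem ip_smul_right (c : ℝ) (x y : E) : ip x (c • y) = c * ip x y := by
  simp only [ip, PiLp.smul_apply, smul_eq_mul]; ring
theorem ip_neg_left (x y : E) : ip (-x) y = -ip x y := by
  simp only [ip, PiLp.neg_apply]; ring
theorem ip_neg_right (x y : E) : ip x (-y) = -ip x y := by
  simp only [ip, PiLp.neg_apply]; ring

/-- The scalar product as a continuous bilinear map. -/
noncomputable def ipB : E →L[ℝ] E →L[ℝ] ℝ :=
  (LinearMap.mk₂ ℝ ip ip_add_left (fun c x y => ip_smul_left c x y) ip_add_right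
    (fun c x y => ip_smul_right c x y)).toContinuousBilinearMap

theorem ipB_apply (x y : E) : ipB x y = ip x y := rfl

/-! ### Bivectors -/

theorem wedge_swap (x y : E) : wedge y x = -wedge x y := by
  have h := (exteriorPower.ιMulti ℝ 2 (M := E)).map_swap ![x, y] (i := 0) (j := 1) (by decide)
  unfold wedge
  rw [← h]
  congr 1
  ext i j
  fin_cases i <;> simp

theorem wedge_self (x : E) : wedge x x = 0 :=
  (exteriorPower.ιMulti ℝ 2 (M := E)).map_eq_zero_of_eq ![x, x] (i := 0) (j := 1) (by simp)
    (by decide)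

theorem wedge_add_left (x y z : E) : wedge (x + y) z = wedge x z + wedge y z :=
  (exteriorPower.ιMulti ℝ 2 (M := E)).toMultilinearMap.cons_add ![z] x y

theorem wedge_smul_left (c : ℝ) (x z : E) : wedge (c • x) z = c • wedge x z :=
  (exteriorPower.ιMulti ℝ 2 (M := E)).toMultilinearMap.cons_smul ![z] c x

theorem wedge_add_right (x y z : E) : wedge x (y + z) = wedge x y + wedge x z := by
  rw [wedge_swap (y + z) x, wedge_swap y x, wedge_swap z x, wedge_add_left, neg_add]

theorem wedge_smul_right (c : ℝ) (x z : E) : wedge x (c • z) = c • wedge x z := by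
  rw [wedge_swap (c • z) x, wedge_swap z x, wedge_smul_left, smul_neg]

/-- The exterior product as a continuous bilinear map. -/
noncomputable def wedgeB : E →L[ℝ] E →L[ℝ] Biv :=
  (LinearMap.mk₂ ℝ wedge wedge_add_left wedge_smul_left wedge_add_right
    wedge_smul_right).toContinuousBilinearMap

theorem map_wedge (A : E →ₗ[ℝ] E) (x y : E) :
    exteriorPower.map 2 A (wedge x y) = wedge (A x) (A y) := by
  unfold wedge
  rw [exteriorPower.map_apply_ιMulti]
  congr 1
  ext i j
  fin_cases i <;> rfl

/-- The pairing of a bivector with `a ∧ b` in the scalar product induced on bivectors. -/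
noncomputable def pair (a b : E) : Biv →ₗ[ℝ] ℝ :=
  exteriorPower.alternatingMapLinearEquiv
    ((Matrix.detRowAlternating (n := Fin 2) (R := ℝ)).compLinearMap
      (LinearMap.pi ![(ipB.flip a).toLinearMap, (ipB.flip b).toLinearMap]))

/-- Components of bivector equations are read off through this Gram determinant, with no basis of
the exterior square. -/
theorem pair_wedge (a b x y : E) :
    pair a b (wedge x y) = ip x a * ip y b - ip x b * ip y a := by
  unfold pair wedge
  rw [exteriorPower.alternatingMapLinearEquiv_apply_ιMulti]
  change Matrix.det (Matrix.of ![![ip x a, ip x b], ![ip y a, ip y b]]) = _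
  rw [Matrix.det_fin_two]
  simp

/-! ### Partial derivatives -/

section Calculus

variable {W : Type*} [NormedAddCommGroup W] [NormedSpace ℝ W]
variable {W' : Type*} [NormedAddCommGroup W'] [NormedSpace ℝ W']
variable {W'' : Type*} [NormedAddCommGroup W''] [NormedSpace ℝ W'']

theorem pd_zero_eq (f : Plane → W) (p : Plane) : pd 0 f p = fderiv ℝ f p (1, 0) := rfl
theorem pd_one_eq (f : Plane → W) (p : Plane) : pd 1 f p = fderiv ℝ f p (0, 1) := rfl

theorem fderiv_apply_eq_pd (f : Plane → W) (p v : Plane) :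
    fderiv ℝ f p v = v.1 • pd 0 f p + v.2 • pd 1 f p := by
  rw [pd_zero_eq, pd_one_eq, ← map_smul, ← map_smul, ← map_add]
  congr 1
  ext <;> simp

theorem dAt {f : Plane → W} {p : Plane} (hf : ContDiffAt ℝ ∞ f p) :
    DifferentiableAt ℝ f p := hf.differentiableAt (by simp)

theorem contDiffAt_pd {f : Plane → W} {p : Plane} (hf : ContDiffAt ℝ ∞ f p) (i : Fin 2) :
    ContDiffAt ℝ ∞ (pd i f) p :=
  (hf.fderiv_right (m := ∞) (by norm_cast)).clm_apply contDiffAt_const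

theorem pd_comm {f : Plane → W} {p : Plane} (hf : ContDiffAt ℝ ∞ f p) (i j : Fin 2) :
    pd i (pd j f) p = pd j (pd i f) p := by
  have hd : DifferentiableAt ℝ (fderiv ℝ f) p :=
    (hf.fderiv_right (m := ∞) (by norm_cast)).differentiableAt (by simp)
  have key : ∀ k l : Fin 2, pd k (pd l f) p = fderiv ℝ (fderiv ℝ f) p
      ((![((1 : ℝ), (0 : ℝ)), ((0 : ℝ), (1 : ℝ))] : Fin 2 → Plane) k)
      ((![((1 : ℝ), (0 : ℝ)), ((0 : ℝ), (1 : ℝ))] : Fin 2 → Plane) l) := by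
    intro k l
    unfold pd
    rw [fderiv_clm_apply hd (differentiableAt_const _)]
    simp
  rw [key, key]
  exact (hf.isSymmSndFDerivAt (by simpa using WithTop.coe_le_coe.2 (le_top (a := (2 : ℕ∞))))).eq _ _

theorem pd_congr {f g : Plane → W} {p : Plane} (h : f =ᶠ[𝓝 p] g) (i : Fin 2) :
    pd i f p = pd i g p := by
  unfold pd; rw [h.fderiv_eq]

theorem pd_congr_nhds {f g : Plane → W} {p : Plane} (h : f =ᶠ[𝓝 p] g) (i : Fin 2) :
    pd i f =ᶠ[𝓝 p] pd i g :=
  h.eventuallyEq_nhds.mono fun _ hq => pd_congr hq i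

theorem pd_const (c : W) (i : Fin 2) (p : Plane) : pd i (fun _ => c) p = 0 := by
  simp [pd]

theorem pd_add {f g : Plane → W} {p : Plane} (hf : DifferentiableAt ℝ f p)
    (hg : DifferentiableAt ℝ g p) (i : Fin 2) :
    pd i (fun q => f q + g q) p = pd i f p + pd i g p := by
  unfold pd; rw [fderiv_fun_add hf hg]; rfl

theorem pd_sub {f g : Plane → W} {p : Plane} (hf : DifferentiableAt ℝ f p)
    (hg : DifferentiableAt ℝ g p) (i : Fin 2) :
    pd i (fun q => f q - g q) p = pd i f p - pd i g p := by
  unfold pd; rw [fderiv_fun_sub hf hg]; rfl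

theorem pd_clm (L : W →L[ℝ] W') {f : Plane → W} {p : Plane} (hf : DifferentiableAt ℝ f p)
    (i : Fin 2) : pd i (fun q => L (f q)) p = L (pd i f p) := by
  unfold pd
  rw [show (fun q => L (f q)) = L ∘ f from rfl, (L.hasFDerivAt.comp p hf.hasFDerivAt).fderiv]
  rfl

theorem pd_bilin (B : W →L[ℝ] W' →L[ℝ] W'') {f : Plane → W} {g : Plane → W'} {p : Plane}
    (hf : DifferentiableAt ℝ f p) (hg : DifferentiableAt ℝ g p) (i : Fin 2) :
    pd i (fun q => B (f q) (g q)) p = B (pd i f p) (g p) + B (f p) (pd i g p) := by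
  unfold pd
  rw [B.fderiv_of_bilinear hf hg, add_comm]
  rfl

theorem pd_smul {f : Plane → ℝ} {g : Plane → W} {p : Plane}
    (hf : DifferentiableAt ℝ f p) (hg : DifferentiableAt ℝ g p) (i : Fin 2) :
    pd i (fun q => f q • g q) p = pd i f p • g p + f p • pd i g p :=
  pd_bilin (ContinuousLinearMap.lsmul ℝ ℝ) hf hg i

theorem pd_const_smul (c : ℝ) {g : Plane → W} {p : Plane} (hg : DifferentiableAt ℝ g p)
    (i : Fin 2) : pd i (fun q => c • g q) p = c • pd i g p := by
  rw [pd_smul (differentiableAt_const c) hg, pd_const, zero_smul, zero_add]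

theorem pd_mul {f g : Plane → ℝ} {p : Plane}
    (hf : DifferentiableAt ℝ f p) (hg : DifferentiableAt ℝ g p) (i : Fin 2) :
    pd i (fun q => f q * g q) p = pd i f p * g p + f p * pd i g p :=
  pd_smul hf hg i

theorem pd_ip {f g : Plane → E} {p : Plane}
    (hf : DifferentiableAt ℝ f p) (hg : DifferentiableAt ℝ g p) (i : Fin 2) :
    pd i (fun q => ip (f q) (g q)) p = ip (pd i f p) (g p) + ip (f p) (pd i g p) :=
  pd_bilin ipB hf hg i

theorem pd_wedge {f g : Plane → E} {p : Plane}
    (hf : DifferentiableAt ℝ f p) (hg : DifferentiableAt ℝ g p) (i : Fin 2) :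
    pd i (fun q => wedge (f q) (g q)) p = wedge (pd i f p) (g p) + wedge (f p) (pd i g p) :=
  pd_bilin wedgeB hf hg i

theorem contDiffAt_bilin (B : W →L[ℝ] W' →L[ℝ] W'') {f : Plane → W} {g : Plane → W'} {p : Plane}
    (hf : ContDiffAt ℝ ∞ f p) (hg : ContDiffAt ℝ ∞ g p) :
    ContDiffAt ℝ ∞ (fun q => B (f q) (g q)) p :=
  ((B.contDiff (n := ∞)).contDiffAt.comp p hf).clm_apply hg

theorem contDiffAt_ip {f g : Plane → E} {p : Plane} (hf : ContDiffAt ℝ ∞ f p)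
    (hg : ContDiffAt ℝ ∞ g p) : ContDiffAt ℝ ∞ (fun q => ip (f q) (g q)) p :=
  contDiffAt_bilin ipB hf hg

theorem contDiffAt_wedge {f g : Plane → E} {p : Plane} (hf : ContDiffAt ℝ ∞ f p)
    (hg : ContDiffAt ℝ ∞ g p) : ContDiffAt ℝ ∞ (fun q => wedge (f q) (g q)) p :=
  contDiffAt_bilin wedgeB hf hg

theorem pd_fst_comp {h : Plane → Plane} {q : Plane} (hh : DifferentiableAt ℝ h q) (a : Fin 2) :
    pd a (fun q => (h q).1) q = (pd a h q).1 :=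
  pd_clm (ContinuousLinearMap.fst ℝ ℝ ℝ) hh a

theorem pd_snd_comp {h : Plane → Plane} {q : Plane} (hh : DifferentiableAt ℝ h q) (a : Fin 2) :
    pd a (fun q => (h q).2) q = (pd a h q).2 :=
  pd_clm (ContinuousLinearMap.snd ℝ ℝ ℝ) hh a

theorem pd_comp {f : Plane → W} {h : Plane → Plane} {q : Plane}
    (hf : DifferentiableAt ℝ f (h q)) (hh : DifferentiableAt ℝ h q) (a : Fin 2) :
    pd a (fun q => f (h q)) q =
      (pd a (fun q => (h q).1) q) • pd 0 f (h q) + (pd a (fun q => (h q).2) q) • pd 1 f (h q) := by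
  rw [pd_fst_comp hh, pd_snd_comp hh, ← fderiv_apply_eq_pd]
  unfold pd
  rw [show (fun q => f (h q)) = f ∘ h from rfl, fderiv_comp q hf hh]
  rfl

theorem det_fderiv_eq {h : Plane → Plane} {q : Plane} (hh : DifferentiableAt ℝ h q) :
    (fderiv ℝ h q).det = pd 0 (fun q => (h q).1) q * pd 1 (fun q => (h q).2) q
      - pd 1 (fun q => (h q).1) q * pd 0 (fun q => (h q).2) q := by
  rw [pd_fst_comp hh, pd_fst_comp hh, pd_snd_comp hh, pd_snd_comp hh, ContinuousLinearMap.det,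
    ← LinearMap.det_toMatrix (Module.Basis.finTwoProd ℝ), Matrix.det_fin_two]
  simp [LinearMap.toMatrix_apply, pd]

end Calculus

/-! ### Null frames -/

/-- The four pairings with the frame define a linear map to `ℝ⁴` that is onto by an explicit
preimage, hence injective by dimension. Both sides have the same pairings. -/
theorem null_frame_expand {X Y n m : E} (hXX : ip X X = 0) (hYY : ip Y Y = 0)
    (hXY : ip X Y = -1) (hnn : ip n n = 0) (hnX : ip n X = 0) (hnY : ip n Y = 0)
    (hmm : ip m m = 0) (hmX : ip m X = 0) (hmY : ip m Y = 0) (hnm : ip n m = -1) (v : E) :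
    v = -(ip v Y) • X - (ip v X) • Y - (ip v m) • n - (ip v n) • m := by
  have hYX : ip Y X = -1 := by rw [ip_comm]; exact hXY
  have hXn : ip X n = 0 := by rw [ip_comm]; exact hnX
  have hYn : ip Y n = 0 := by rw [ip_comm]; exact hnY
  have hXm : ip X m = 0 := by rw [ip_comm]; exact hmX
  have hYm : ip Y m = 0 := by rw [ip_comm]; exact hmY
  have hmn : ip m n = -1 := by rw [ip_comm]; exact hnm
  let T : E →ₗ[ℝ] (Fin 4 → ℝ) := LinearMap.pi ![(ipB.flip X).toLinearMap,
    (ipB.flip Y).toLinearMap, (ipB.flip n).toLinearMap, (ipB.flip m).toLinearMap]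
  have hT (w : E) : T w = ![ip w X, ip w Y, ip w n, ip w m] := by
    ext i; fin_cases i <;> rfl
  have hsurj : Function.Surjective T := by
    intro c
    refine ⟨-(c 1) • X - (c 0) • Y - (c 3) • n - (c 2) • m, ?_⟩
    rw [hT]
    ext i
    fin_cases i <;>
      simp [ip_sub_left, ip_neg_left, ip_smul_left, *]
  have hinj : Function.Injective T :=
    (LinearMap.injective_iff_surjective_of_finrank_eq_finrank (by simp)).2 hsurj
  apply hinj
  rw [hT, hT]
  ext i
  fin_cases i <;>
    simp [ip_sub_left, ip_neg_left, ip_smul_left, *]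

theorem exists_null_frame {X Y n : E} (hXX : ip X X = 0) (hYY : ip Y Y = 0)
    (hXY : ip X Y = -1) (hnn : ip n n = 0) (hnX : ip n X = 0) (hnY : ip n Y = 0) (hn : n ≠ 0) :
    ∃ m, ip m m = 0 ∧ ip m X = 0 ∧ ip m Y = 0 ∧ ip n m = -1 := by
  have hYX : ip Y X = -1 := by rw [ip_comm]; exact hXY
  have hXn : ip X n = 0 := by rw [ip_comm]; exact hnX
  have hYn : ip Y n = 0 := by rw [ip_comm]; exact hnY
  -- Flipping the two negative directions makes `⟨n, m₀⟩` the Euclidean square norm of `n`, so it is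
  -- positive.
  let m₀ : E := !₂[n 0, n 1, -n 2, -n 3]
  have h0 : 0 < ip n m₀ := by
    have h1 : ip n m₀ = ‖n‖ ^ 2 := by
      rw [EuclideanSpace.norm_sq_eq, Fin.sum_univ_four]
      simp [ip, m₀]; ring
    rw [h1]; positivity
  set d := ip n m₀ with hd
  have hd' : ip m₀ n = d := by rw [ip_comm]
  -- The normal projection of `m₀`. It still pairs to `d` with `n`; scaling by `-1/d` and adding a
  -- multiple of `n` then makes it null.
  let m₁ : E := m₀ + ip m₀ Y • X + ip m₀ X • Y
  have h1X : ip m₁ X = 0 := by simp [m₁, ip_add_left, ip_smul_left, *]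
  have h1Y : ip m₁ Y = 0 := by simp [m₁, ip_add_left, ip_smul_left, *]
  have h1n : ip m₁ n = d := by simp [m₁, ip_add_left, ip_smul_left, *]
  have hn1 : ip n m₁ = d := by rw [ip_comm]; exact h1n
  refine ⟨-(1 / d) • m₁ + (ip m₁ m₁ / (2 * d ^ 2)) • n, ?_, ?_, ?_, ?_⟩
  · simp only [ip_add_left, ip_add_right, ip_smul_left, ip_smul_right, h1n, hn1, hnn]
    field_simp
    ring
  · rw [ip_add_left, ip_smul_left, ip_smul_left, h1X, hnX]; ring
  · rw [ip_add_left, ip_smul_left, ip_smul_left, h1Y, hnY]; ring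
  · simp only [ip_add_right, ip_smul_right, hn1, hnn]
    field_simp
    ring

/-! ### Surfaces parametrized by flat null coordinates -/

/-- On the open set `S` the surface `x` is smooth with induced metric `-2 du dv`. -/
structure NullParam (x : Plane → E) (S : Set Plane) : Prop where
  isOpen : IsOpen S
  smooth : ∀ q ∈ S, ContDiffAt ℝ ∞ x q
  uu : ∀ q ∈ S, ip (pd 0 x q) (pd 0 x q) = 0
  vv : ∀ q ∈ S, ip (pd 1 x q) (pd 1 x q) = 0
  uv : ∀ q ∈ S, ip (pd 0 x q) (pd 1 x q) = -1

theorem pd_ip_of_const {f g : Plane → E} {S : Set Plane} {q : Plane} {c : ℝ} (hS : IsOpen S)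
    (hq : q ∈ S) (hf : ContDiffAt ℝ ∞ f q) (hg : ContDiffAt ℝ ∞ g q)
    (h : ∀ q ∈ S, ip (f q) (g q) = c) (i : Fin 2) :
    ip (pd i f q) (g q) + ip (f q) (pd i g q) = 0 := by
  rw [← pd_ip (dAt hf) (dAt hg), pd_congr (g := fun _ => c), pd_const]
  exact mem_of_superset (hS.mem_nhds hq) h

namespace NullParam

variable {x : Plane → E} {S : Set Plane} (hx : NullParam x S)
include hx

theorem mono {S' : Set Plane} (h : S' ⊆ S) (hS' : IsOpen S') : NullParam x S' :=
  ⟨hS', fun q hq => hx.smooth q (h hq), fun q hq => hx.uu q (h hq), fun q hq => hx.vv q (h hq),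
    fun q hq => hx.uv q (h hq)⟩

theorem smooth_pd (i : Fin 2) {q : Plane} (hq : q ∈ S) : ContDiffAt ℝ ∞ (pd i x) q :=
  contDiffAt_pd (hx.smooth q hq) i

theorem smooth_pd_pd (i j : Fin 2) {q : Plane} (hq : q ∈ S) :
    ContDiffAt ℝ ∞ (pd i (pd j x)) q :=
  contDiffAt_pd (hx.smooth_pd j hq) i

theorem comm {q : Plane} (hq : q ∈ S) : pd 1 (pd 0 x) q = pd 0 (pd 1 x) q :=
  pd_comm (hx.smooth q hq) 1 0

/-- This and the next five lemmas come from differentiating the constant metric coefficients.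
Together they say that the Christoffel symbols vanish, so all second derivatives are normal. -/
theorem uu_u {q : Plane} (hq : q ∈ S) : ip (pd 0 (pd 0 x) q) (pd 0 x q) = 0 := by
  have := pd_ip_of_const hx.isOpen hq (hx.smooth_pd 0 hq) (hx.smooth_pd 0 hq) hx.uu 0
  rw [ip_comm (pd 0 x q)] at this
  linarith

theorem vv_v {q : Plane} (hq : q ∈ S) : ip (pd 1 (pd 1 x) q) (pd 1 x q) = 0 := by
  have := pd_ip_of_const hx.isOpen hq (hx.smooth_pd 1 hq) (hx.smooth_pd 1 hq) hx.vv 1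
  rw [ip_comm (pd 1 x q)] at this
  linarith

theorem uv_u {q : Plane} (hq : q ∈ S) : ip (pd 0 (pd 1 x) q) (pd 0 x q) = 0 := by
  have := pd_ip_of_const hx.isOpen hq (hx.smooth_pd 0 hq) (hx.smooth_pd 0 hq) hx.uu 1
  rw [ip_comm (pd 0 x q), hx.comm hq] at this
  linarith

theorem uv_v {q : Plane} (hq : q ∈ S) : ip (pd 0 (pd 1 x) q) (pd 1 x q) = 0 := by
  have := pd_ip_of_const hx.isOpen hq (hx.smooth_pd 1 hq) (hx.smooth_pd 1 hq) hx.vv 0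
  rw [ip_comm (pd 1 x q)] at this
  linarith

theorem uu_v {q : Plane} (hq : q ∈ S) : ip (pd 0 (pd 0 x) q) (pd 1 x q) = 0 := by
  have := pd_ip_of_const hx.isOpen hq (hx.smooth_pd 0 hq) (hx.smooth_pd 1 hq) hx.uv 0
  rw [ip_comm (pd 0 x q), hx.uv_u hq] at this
  linarith

theorem vv_u {q : Plane} (hq : q ∈ S) : ip (pd 1 (pd 1 x) q) (pd 0 x q) = 0 := by
  have := pd_ip_of_const hx.isOpen hq (hx.smooth_pd 0 hq) (hx.smooth_pd 1 hq) hx.uv 1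
  rw [ip_comm (pd 0 x q), hx.comm hq, hx.uv_v hq] at this
  linarith

end NullParam

/-! ### Change of coordinates -/

section Change

variable {z : Plane → E} {h : Plane → Plane} {S : Set Plane} {q : Plane}

/-- The Jacobian matrix of a map of the parameter plane. -/
noncomputable def jac (h : Plane → Plane) (q : Plane) : Matrix (Fin 2) (Fin 2) ℝ :=
  !![pd 0 (fun q => (h q).1) q, pd 1 (fun q => (h q).1) q;
     pd 0 (fun q => (h q).2) q, pd 1 (fun q => (h q).2) q]

theorem det_jac (hh : DifferentiableAt ℝ h q) : (fderiv ℝ h q).det = (jac h q).det := by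
  rw [det_fderiv_eq hh, jac, Matrix.det_fin_two_of]

theorem metric_comp (hz : DifferentiableAt ℝ z (h q)) (hh : DifferentiableAt ℝ h q) :
    (jac h q).transpose * metric z (h q) * jac h q = metric (fun q => z (h q)) q := by
  have e (a) := pd_comp hz hh a
  ext i j
  simp only [metric, Matrix.of_apply, e]
  fin_cases i <;> fin_cases j <;>
    simp [jac, Matrix.mul_apply, Fin.sum_univ_two, ip_add_left, ip_add_right, ip_smul_left,
      ip_smul_right] <;> ring

theorem NullParam.metric_eq {x : Plane → E} (hx : NullParam x S) (hq : q ∈ S) :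
    metric x q = !![0, -1; -1, 0] := by
  ext i j
  fin_cases i <;> fin_cases j
  · exact hx.uu q hq
  · exact hx.uv q hq
  · exact (ip_comm _ _).trans (hx.uv q hq)
  · exact hx.vv q hq

theorem pd_pd_comp {W : Type*} [NormedAddCommGroup W] [NormedSpace ℝ W] {f : Plane → W}
    (hf : ContDiffAt ℝ ∞ f (h q)) (hh : ContDiffAt ℝ ∞ h q) :
    pd 0 (pd 1 (fun q => f (h q))) q =
      (pd 0 (pd 1 (fun q => (h q).1)) q) • pd 0 f (h q)
      + (pd 0 (pd 1 (fun q => (h q).2)) q) • pd 1 f (h q)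
      + (jac h q 0 0 * jac h q 0 1) • pd 0 (pd 0 f) (h q)
      + (jac h q 0 0 * jac h q 1 1 + jac h q 0 1 * jac h q 1 0) • pd 0 (pd 1 f) (h q)
      + (jac h q 1 0 * jac h q 1 1) • pd 1 (pd 1 f) (h q) := by
  have hcont : Tendsto h (𝓝 q) (𝓝 (h q)) := hh.continuousAt
  have h1 : ContDiffAt ℝ ∞ (fun q => (h q).1) q := hh.fst
  have h2 : ContDiffAt ℝ ∞ (fun q => (h q).2) q := hh.snd
  have ev : pd 1 (fun q => f (h q)) =ᶠ[𝓝 q] fun q =>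
      (pd 1 (fun q => (h q).1) q) • pd 0 f (h q) + (pd 1 (fun q => (h q).2) q) • pd 1 f (h q) := by
    have e1 : ∀ᶠ q' in 𝓝 q, ContDiffAt ℝ 1 h q' :=
      (hh.of_le (by norm_cast)).eventually (by simp)
    have e2 : ∀ᶠ q' in 𝓝 q, ContDiffAt ℝ 1 f (h q') :=
      hcont.eventually ((hf.of_le (by norm_cast)).eventually (by simp))
    filter_upwards [e1, e2] with q' a b
    exact pd_comp (b.differentiableAt (by simp)) (a.differentiableAt (by simp)) 1
  have c (i : Fin 2) : DifferentiableAt ℝ (fun q => pd i f (h q)) q :=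
    (dAt (contDiffAt_pd hf i)).comp q (dAt hh)
  have d0 : DifferentiableAt ℝ (fun q => pd 1 (fun q => (h q).1) q • pd 0 f (h q)) q :=
    (dAt (contDiffAt_pd h1 1)).smul (c 0)
  have d1 : DifferentiableAt ℝ (fun q => pd 1 (fun q => (h q).2) q • pd 1 f (h q)) q :=
    (dAt (contDiffAt_pd h2 1)).smul (c 1)
  rw [pd_congr ev, pd_add d0 d1, pd_smul (dAt (contDiffAt_pd h1 1)) (c 0),
    pd_smul (dAt (contDiffAt_pd h2 1)) (c 1), pd_comp (dAt (contDiffAt_pd hf 0)) (dAt hh),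
    pd_comp (dAt (contDiffAt_pd hf 1)) (dAt hh), pd_comm hf 1 0]
  simp only [jac, Matrix.of_apply, Matrix.cons_val', Matrix.cons_val_zero, Matrix.cons_val_one,
    Matrix.cons_val_fin_one]
  module

variable (hx : NullParam (fun q => z (h q)) S) (hq : q ∈ S) (hz : ContDiffAt ℝ ∞ z (h q))
  (hh : ContDiffAt ℝ ∞ h q)
include hx hq hz hh

theorem det_metric_comp : (jac h q).det ^ 2 * (metric z (h q)).det = -1 := by
  have := congrArg Matrix.det (metric_comp (dAt hz) (dAt hh))
  rw [hx.metric_eq hq, Matrix.det_mul, Matrix.det_mul, Matrix.det_transpose,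
    Matrix.det_fin_two_of] at this
  linarith

/-- With `N` the constant null matrix, `Jᵀ g J = N` and `N² = 1` give `g⁻¹ = J N Jᵀ`, with no
inverse of `J` involved. -/
theorem metric_inv_comp :
    (metric z (h q))⁻¹ = jac h q * !![0, -1; -1, 0] * (jac h q).transpose := by
  have h1 := metric_comp (dAt hz) (dAt hh)
  rw [hx.metric_eq hq] at h1
  have h2 : (!![0, -1; -1, 0] : Matrix (Fin 2) (Fin 2) ℝ) * !![0, -1; -1, 0] = 1 := by
    ext i j; fin_cases i <;> fin_cases j <;> simp [Matrix.mul_apply, Fin.sum_univ_two]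
  apply Matrix.inv_eq_left_inv
  rw [Matrix.mul_assoc, Matrix.mul_assoc, mul_eq_one_comm, Matrix.mul_assoc, Matrix.mul_assoc,
    ← Matrix.mul_assoc _ (metric z (h q)), h1, h2]

theorem gaussMap_comp {σ : ℝ} (hσ : σ = 1 ∨ σ = -1) (hdet : 0 < σ * (jac h q).det) :
    gaussMap z (h q) = σ • wedge (pd 0 (fun q => z (h q)) q) (pd 1 (fun q => z (h q)) q) := by
  have hd := det_metric_comp hx hq hz hh
  set J := (jac h q).det with hJ
  have hσ2 : σ * σ = 1 := by rcases hσ with rfl | rfl <;> norm_num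
  -- From `J² det g = -1`, the root is `1/|J|`, and `|J| = σ J`.
  have hs : Real.sqrt (-(metric z (h q)).det) = (σ * J)⁻¹ := by
    rw [Real.sqrt_eq_iff_mul_self_eq (by nlinarith [sq_nonneg J]) (by positivity)]
    have : J ≠ 0 := by rintro h0; simp [h0] at hdet
    rw [← mul_inv]
    apply eq_inv_of_mul_eq_one_left
    linear_combination (-(metric z (h q)).det * J ^ 2) * hσ2 - hd
  have hw : wedge (pd 0 (fun q => z (h q)) q) (pd 1 (fun q => z (h q)) q)
      = J • wedge (pd 0 z (h q)) (pd 1 z (h q)) := by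
    rw [pd_comp (dAt hz) (dAt hh), pd_comp (dAt hz) (dAt hh), hJ, jac, Matrix.det_fin_two_of]
    simp only [wedge_add_left, wedge_add_right, wedge_smul_left, wedge_smul_right, wedge_self,
      wedge_swap (pd 0 z (h q)) (pd 1 z (h q))]
    module
  rw [gaussMap, hs, hw, inv_inv, smul_smul]

/-- The second-order terms agree by the formula for `g⁻¹`. The first-order terms agree because
`z_uv` is normal, which identifies the trace of the Christoffel symbols with twice the mixed
derivative of the components of `h`. -/
theorem laplacian_comp {W : Type*} [NormedAddCommGroup W] [NormedSpace ℝ W] {f : Plane → W}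
    (hf : ContDiffAt ℝ ∞ f (h q)) :
    laplacian z f (h q) = (2 : ℝ) • pd 0 (pd 1 (fun q => f (h q))) q := by
  have hinv := metric_inv_comp hx hq hz hh
  have hfpd := pd_pd_comp hf hh
  have hzpd := pd_pd_comp hz hh
  have hdet := det_metric_comp hx hq hz hh
  have hu := hx.uv_u hq
  have hv := hx.uv_v hq
  rw [pd_comp (dAt hz) (dAt hh)] at hu hv
  have hgi : (metric z (h q))⁻¹ * metric z (h q) = 1 := by
    apply Matrix.nonsing_inv_mul
    rw [isUnit_iff_ne_zero]
    rintro h0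
    simp [h0] at hdet
  set U := pd 0 (pd 1 (fun q => (h q).1)) q
  set V := pd 0 (pd 1 (fun q => (h q).2)) q
  set n := pd 0 (pd 1 fun q => z (h q)) q
  rw [show pd 0 (fun q => (h q).1) q = jac h q 0 0 from rfl,
    show pd 0 (fun q => (h q).2) q = jac h q 1 0 from rfl] at hu
  rw [show pd 1 (fun q => (h q).1) q = jac h q 0 1 from rfl,
    show pd 1 (fun q => (h q).2) q = jac h q 1 1 from rfl] at hv
  have hJ : (jac h q).det ≠ 0 := by rintro h0; simp [h0] at hdet
  rw [Matrix.det_fin_two] at hJ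
  simp only [ip_add_right, ip_smul_right] at hu hv
  -- Orthogonality to the `u` and `v` directions is transferred to the original coordinate fields by
  -- inverting the Jacobian matrix.
  have n0 : ip n (pd 0 z (h q)) = 0 := by
    apply mul_left_cancel₀ hJ
    linear_combination jac h q 1 1 * hu - jac h q 1 0 * hv
  have n1 : ip n (pd 1 z (h q)) = 0 := by
    apply mul_left_cancel₀ hJ
    linear_combination jac h q 0 0 * hv - jac h q 0 1 * hu
  set J := jac h q
  have g00 : (metric z (h q))⁻¹ 0 0 = -(2 * (J 0 0 * J 0 1)) := by
    rw [hinv]; simp [Matrix.mul_apply, Fin.sum_univ_two]; try ring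
  have g01 : (metric z (h q))⁻¹ 0 1 = -(J 0 0 * J 1 1 + J 0 1 * J 1 0) := by
    rw [hinv]; simp [Matrix.mul_apply, Fin.sum_univ_two]; try ring
  have g10 : (metric z (h q))⁻¹ 1 0 = -(J 0 0 * J 1 1 + J 0 1 * J 1 0) := by
    rw [hinv]; simp [Matrix.mul_apply, Fin.sum_univ_two]; try ring
  have g11 : (metric z (h q))⁻¹ 1 1 = -(2 * (J 1 0 * J 1 1)) := by
    rw [hinv]; simp [Matrix.mul_apply, Fin.sum_univ_two]; try ring
  -- This is `⟨n, ∂ₗ z⟩ = 0` after expanding `n` by the second-order chain rule.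
  have trace (l : Fin 2) : ∑ i, ∑ j, (metric z (h q))⁻¹ i j * ip (pd i (pd j z) (h q)) (pd l z (h q))
      = 2 * (U * metric z (h q) 0 l + V * metric z (h q) 1 l) := by
    have hn : ip n (pd l z (h q)) = 0 := by fin_cases l; exacts [n0, n1]
    have hm (i : Fin 2) : metric z (h q) i l = ip (pd i z (h q)) (pd l z (h q)) := rfl
    rw [hzpd] at hn
    simp only [ip_add_left, ip_smul_left] at hn
    simp only [Fin.sum_univ_two, g00, g01, g10, g11, pd_comm hz 1 0, hm]
    linear_combination -2 * hn
  have chr (k : Fin 2) : ∑ i, ∑ j, (metric z (h q))⁻¹ i j * christoffel z k i j (h q)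
      = 2 * (![U, V] k) := by
    have e : ∑ i, ∑ j, (metric z (h q))⁻¹ i j * christoffel z k i j (h q)
      = ∑ l, (metric z (h q))⁻¹ k l *
        ∑ i, ∑ j, (metric z (h q))⁻¹ i j * ip (pd i (pd j z) (h q)) (pd l z (h q)) := by
      simp only [christoffel, Fin.sum_univ_two]; ring
    rw [e]
    simp only [trace]
    have i0 := congrFun (congrFun hgi k) 0
    have i1 := congrFun (congrFun hgi k) 1
    have hk (k : Fin 2) : (![U, V] k : ℝ) = U * (1 : Matrix (Fin 2) (Fin 2) ℝ) k 0
        + V * (1 : Matrix (Fin 2) (Fin 2) ℝ) k 1 := by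
      revert k
      simp [Fin.forall_fin_two]
    simp only [Matrix.mul_apply, Fin.sum_univ_two] at i0 i1 ⊢
    rw [hk]
    have s : metric z (h q) 0 1 = metric z (h q) 1 0 := ip_comm _ _
    linear_combination 2 * U * i0 + 2 * V * i1 + (2 * U * (metric z (h q))⁻¹ k 1
      - 2 * V * (metric z (h q))⁻¹ k 0) * s
  have c0 := chr 0
  have c1 := chr 1
  simp only [Fin.sum_univ_two, g00, g01, g10, g11, Matrix.cons_val_zero, Matrix.cons_val_one] at c0 c1
  rw [hfpd, laplacian]
  simp only [Fin.sum_univ_two, g00, g01, g10, g11, pd_comm hf 1 0]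
  have e0 : U • pd 0 f (h q) = ((2 : ℝ)⁻¹ * (2 * U)) • pd 0 f (h q) := by
    congr 1; ring
  have e1 : V • pd 1 f (h q) = ((2 : ℝ)⁻¹ * (2 * V)) • pd 1 f (h q) := by
    congr 1; ring
  rw [e0, e1, ← c0, ← c1]
  module

end Change

/-! ### The tangent bivector and its mixed derivative -/

theorem NullParam.pd_pd_wedge {x : Plane → E} {S : Set Plane} (hx : NullParam x S) {q : Plane}
    (hq : q ∈ S) :
    pd 0 (pd 1 (fun q => wedge (pd 0 x q) (pd 1 x q))) q =
      wedge (pd 0 (pd 0 (pd 1 x)) q) (pd 1 x q) + wedge (pd 0 (pd 0 x) q) (pd 1 (pd 1 x) q)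
        + wedge (pd 0 x q) (pd 1 (pd 0 (pd 1 x)) q) := by
  have ev : pd 1 (fun q => wedge (pd 0 x q) (pd 1 x q)) =ᶠ[𝓝 q] fun q =>
      wedge (pd 0 (pd 1 x) q) (pd 1 x q) + wedge (pd 0 x q) (pd 1 (pd 1 x) q) := by
    filter_upwards [hx.isOpen.mem_nhds hq] with q' hq'
    rw [pd_wedge (dAt (hx.smooth_pd 0 hq')) (dAt (hx.smooth_pd 1 hq')), hx.comm hq']
  have s0 := hx.smooth_pd 0 hq
  have s1 := hx.smooth_pd 1 hq
  have s01 := hx.smooth_pd_pd 0 1 hq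
  have s11 := hx.smooth_pd_pd 1 1 hq
  rw [pd_congr ev, pd_add (dAt (contDiffAt_wedge s01 s1)) (dAt (contDiffAt_wedge s0 s11)),
    pd_wedge (dAt s01) (dAt s1), pd_wedge (dAt s0) (dAt s11), wedge_self, add_zero,
    pd_comm s1 0 1, add_assoc]

theorem biv_hom_ext {W : Type*} [AddCommGroup W] [Module ℝ W] {L L' : Biv →ₗ[ℝ] W}
    (h : ∀ x y, L (wedge x y) = L' (wedge x y)) : L = L' := by
  apply exteriorPower.linearMap_ext
  ext v
  have hv : v = ![v 0, v 1] := by ext i j; fin_cases i <;> rfl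
  rw [hv]
  exact h _ _

theorem pair_add_left (a a' b : E) : pair (a + a') b = pair a b + pair a' b :=
  biv_hom_ext fun x y => by
    simp only [pair_wedge, LinearMap.add_apply, ip_add_right]; ring

theorem pair_add_right (a b b' : E) : pair a (b + b') = pair a b + pair a b' :=
  biv_hom_ext fun x y => by
    simp only [pair_wedge, LinearMap.add_apply, ip_add_right]; ring

theorem pair_smul_left (c : ℝ) (a b : E) : pair (c • a) b = c • pair a b :=
  biv_hom_ext fun x y => by
    simp only [pair_wedge, LinearMap.smul_apply, ip_smul_right, smul_eq_mul]; ring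

theorem pair_smul_right (c : ℝ) (a b : E) : pair a (c • b) = c • pair a b :=
  biv_hom_ext fun x y => by
    simp only [pair_wedge, LinearMap.smul_apply, ip_smul_right, smul_eq_mul]; ring

/-- The pairing of a fixed bivector with `a ∧ b`, as a continuous bilinear map of `a`, `b`. -/
noncomputable def pairB (C : Biv) : E →L[ℝ] E →L[ℝ] ℝ :=
  (LinearMap.mk₂ ℝ (fun a b => pair a b C) (fun a a' b => by simp [pair_add_left])
    (fun c a b => by simp [pair_smul_left]) (fun a b b' => by simp [pair_add_right])
    (fun c a b => by simp [pair_smul_right])).toContinuousBilinearMap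

theorem pd_pair_of_zero {f g : Plane → E} {S : Set Plane} {q : Plane} {C : Biv} (hS : IsOpen S)
    (hq : q ∈ S) (hf : ContDiffAt ℝ ∞ f q) (hg : ContDiffAt ℝ ∞ g q)
    (h : ∀ q ∈ S, pair (f q) (g q) C = 0) (i : Fin 2) :
    pair (pd i f q) (g q) C + pair (f q) (pd i g q) C = 0 := by
  have e : pd i (fun q => pair (f q) (g q) C) q
      = pair (pd i f q) (g q) C + pair (f q) (pd i g q) C :=
    pd_bilin (pairB C) (dAt hf) (dAt hg) i
  rw [← e, pd_congr (g := fun _ => (0 : ℝ)), pd_const]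
  exact mem_of_superset (hS.mem_nhds hq) h

theorem eq_of_pd_eq_zero {W : Type*} [NormedAddCommGroup W] [NormedSpace ℝ W] {f : Plane → W}
    {B : Set Plane} (hB : IsOpen B) (hc : Convex ℝ B) (hf : ∀ q ∈ B, DifferentiableAt ℝ f q)
    (h0 : ∀ q ∈ B, ∀ i, pd i f q = 0) {q q' : Plane} (hq : q ∈ B) (hq' : q' ∈ B) :
    f q = f q' := by
  apply hB.is_const_of_fderiv_eq_zero (𝕜 := ℝ) hc.isPreconnected
    (fun q hq => (hf q hq).differentiableWithinAt) _ hq hq'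
  intro r hr
  refine ContinuousLinearMap.ext fun v => ?_
  rw [fderiv_apply_eq_pd, h0 r hr 0, h0 r hr 1]
  simp

/-! ### Rigidity: the 1-type equation confines the second fundamental form to one null direction -/

section Rigidity

variable {x : Plane → E} {S : Set Plane} (hx : NullParam x S)
  (hnn : ∀ q ∈ S, ip (pd 0 (pd 1 x) q) (pd 0 (pd 1 x) q) = 0)
include hx hnn

namespace NullParam

theorem n_n (i : Fin 2) {q : Plane} (hq : q ∈ S) :
    ip (pd i (pd 0 (pd 1 x)) q) (pd 0 (pd 1 x) q) = 0 := by
  have := pd_ip_of_const hx.isOpen hq (hx.smooth_pd_pd 0 1 hq) (hx.smooth_pd_pd 0 1 hq) hnn i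
  rw [ip_comm (pd 0 (pd 1 x) q)] at this
  linarith

omit hnn in
theorem nu_u {q : Plane} (hq : q ∈ S) :
    ip (pd 0 (pd 0 (pd 1 x)) q) (pd 0 x q) = -ip (pd 0 (pd 0 x) q) (pd 0 (pd 1 x) q) := by
  have := pd_ip_of_const hx.isOpen hq (hx.smooth_pd_pd 0 1 hq) (hx.smooth_pd 0 hq)
    (fun q hq => hx.uv_u hq) 0
  rw [ip_comm (pd 0 (pd 1 x) q)] at this
  linarith

theorem nv_u {q : Plane} (hq : q ∈ S) : ip (pd 1 (pd 0 (pd 1 x)) q) (pd 0 x q) = 0 := by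
  have := pd_ip_of_const hx.isOpen hq (hx.smooth_pd_pd 0 1 hq) (hx.smooth_pd 0 hq)
    (fun q hq => hx.uv_u hq) 1
  rw [hx.comm hq, hnn q hq] at this
  linarith

theorem nu_v {q : Plane} (hq : q ∈ S) : ip (pd 0 (pd 0 (pd 1 x)) q) (pd 1 x q) = 0 := by
  have := pd_ip_of_const hx.isOpen hq (hx.smooth_pd_pd 0 1 hq) (hx.smooth_pd 1 hq)
    (fun q hq => hx.uv_v hq) 0
  rw [hnn q hq] at this
  linarith

omit hnn in
theorem nv_v {q : Plane} (hq : q ∈ S) :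
    ip (pd 1 (pd 0 (pd 1 x)) q) (pd 1 x q) = -ip (pd 1 (pd 1 x) q) (pd 0 (pd 1 x) q) := by
  have := pd_ip_of_const hx.isOpen hq (hx.smooth_pd_pd 0 1 hq) (hx.smooth_pd 1 hq)
    (fun q hq => hx.uv_v hq) 1
  rw [ip_comm (pd 0 (pd 1 x) q)] at this
  linarith

/-- The Gauss equation of the flat surface, with right side `⟨n, n⟩ = 0`. It comes from
differentiating `⟨x_uu, x_v⟩ = 0` in `v`. -/
theorem uu_vv {q : Plane} (hq : q ∈ S) : ip (pd 0 (pd 0 x) q) (pd 1 (pd 1 x) q) = 0 := by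
  have := pd_ip_of_const hx.isOpen hq (hx.smooth_pd_pd 0 0 hq) (hx.smooth_pd 1 hq)
    (fun q hq => hx.uu_v hq) 1
  have e : pd 1 (pd 0 (pd 0 x)) q = pd 0 (pd 0 (pd 1 x)) q := by
    rw [pd_comm (hx.smooth_pd 0 hq) 1 0]
    apply pd_congr
    filter_upwards [hx.isOpen.mem_nhds hq] with q' hq'
    exact hx.comm hq'
  rw [e, hx.nu_v hnn hq] at this
  linarith

variable (hn : ∀ q ∈ S, pd 0 (pd 1 x) q ≠ 0)
include hn

/-- The expansion of a vector in a null frame made of the coordinate fields, the mean curvature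
direction and a transversal. -/
theorem exists_transversal {q : Plane} (hq : q ∈ S) : ∃ m : E,
    ∀ v : E, v = -(ip v (pd 1 x q)) • pd 0 x q - (ip v (pd 0 x q)) • pd 1 x q
      - (ip v m) • pd 0 (pd 1 x) q - (ip v (pd 0 (pd 1 x) q)) • m := by
  obtain ⟨m, hmm, hmX, hmY, hnm⟩ := exists_null_frame (hx.uu q hq) (hx.vv q hq) (hx.uv q hq)
    (hnn q hq) (hx.uv_u hq) (hx.uv_v hq) (hn q hq)
  exact ⟨m, null_frame_expand (hx.uu q hq) (hx.vv q hq) (hx.uv q hq)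
    (hnn q hq) (hx.uv_u hq) (hx.uv_v hq) hmm hmX hmY hnm⟩

variable {φ : Plane → ℝ} {C : Biv} (hφ : ∀ q ∈ S, φ q ≠ 0)
  (hC : ∀ q ∈ S, (2 : ℝ) • pd 0 (pd 1 (fun q => wedge (pd 0 x q) (pd 1 x q))) q
    = φ q • (wedge (pd 0 x q) (pd 1 x q) + C))
include hφ hC

omit hn in
-- `n ∧ x_u` is orthogonal to `x_u ∧ x_v` and to every term of its mixed derivative, so only `φ`
-- times the pairing with `C` survives, and `φ` has no zero.
theorem pair_n_u {q : Plane} (hq : q ∈ S) : pair (pd 0 (pd 1 x) q) (pd 0 x q) C = 0 := by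
  have h := congrArg (pair (pd 0 (pd 1 x) q) (pd 0 x q)) (hC q hq)
  rw [hx.pd_pd_wedge hq] at h
  simp only [map_smul, map_add, pair_wedge, smul_eq_mul, hx.uu_u hq, hx.vv_u hq, hx.uu q hq,
    hx.n_n hnn 0 hq, ip_comm (pd 0 x q) (pd 0 (pd 1 x) q), ip_comm (pd 1 x q) (pd 0 (pd 1 x) q),
    hx.uv_u hq, hx.uv_v hq] at h
  apply mul_left_cancel₀ (hφ q hq)
  linarith

omit hn in
theorem pair_n_v {q : Plane} (hq : q ∈ S) : pair (pd 0 (pd 1 x) q) (pd 1 x q) C = 0 := by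
  have h := congrArg (pair (pd 0 (pd 1 x) q) (pd 1 x q)) (hC q hq)
  rw [hx.pd_pd_wedge hq] at h
  simp only [map_smul, map_add, pair_wedge, smul_eq_mul, hx.uu_v hq, hx.vv_v hq, hx.vv q hq,
    hx.n_n hnn 1 hq, ip_comm (pd 0 x q) (pd 0 (pd 1 x) q), ip_comm (pd 1 x q) (pd 0 (pd 1 x) q),
    hx.uv_u hq, hx.uv_v hq] at h
  apply mul_left_cancel₀ (hφ q hq)
  linarith

/-- The second fundamental form takes its values in the direction of the mean curvature. -/
theorem uu_n_vv_n {q : Plane} (hq : q ∈ S) :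
    ip (pd 0 (pd 0 x) q) (pd 0 (pd 1 x) q) = 0 ∧ ip (pd 1 (pd 1 x) q) (pd 0 (pd 1 x) q) = 0 := by
  have s0 := hx.smooth_pd 0 hq
  have s1 := hx.smooth_pd 1 hq
  have s01 := hx.smooth_pd_pd 0 1 hq
  -- The relation for `n ∧ x_u` is differentiated in `u`, that for `n ∧ x_v` in `v`. The pairings
  -- with `C` that appear are then eliminated through the 1-type equation itself.
  have d0 := pd_pair_of_zero hx.isOpen hq s01 s0
    (fun q hq => hx.pair_n_u hnn hφ hC hq) 0
  have d1 := pd_pair_of_zero hx.isOpen hq s01 s1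
    (fun q hq => hx.pair_n_v hnn hφ hC hq) 1
  have e0 := congrArg (pair (pd 0 (pd 0 (pd 1 x)) q) (pd 0 x q)) (hC q hq)
  have e1 := congrArg (pair (pd 0 (pd 1 x) q) (pd 0 (pd 0 x) q)) (hC q hq)
  have e2 := congrArg (pair (pd 1 (pd 0 (pd 1 x)) q) (pd 1 x q)) (hC q hq)
  have e3 := congrArg (pair (pd 0 (pd 1 x) q) (pd 1 (pd 1 x) q)) (hC q hq)
  rw [hx.pd_pd_wedge hq] at e0 e1 e2 e3
  have hXX := hx.uu q hq
  have hYY := hx.vv q hq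
  have hXY := hx.uv q hq
  have h1 := hx.uu_u hq
  have h2 := hx.uu_v hq
  have h3 := hx.vv_u hq
  have h4 := hx.vv_v hq
  have h5 := hx.uv_u hq
  have h6 := hx.uv_v hq
  have h7 := hx.nu_u hq
  have h8 := hx.nu_v hnn hq
  have h9 := hx.nv_u hnn hq
  have h10 := hx.nv_v hq
  have h11 := hx.uu_vv hnn hq
  have h12 := hx.n_n hnn 0 hq
  have h13 := hx.n_n hnn 1 hq
  have hp := hφ q hq
  obtain ⟨m, hm⟩ := hx.exists_transversal hnn hn hq
  set X := pd 0 x q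
  set Y := pd 1 x q
  set n := pd 0 (pd 1 x) q
  set P := pd 0 (pd 0 x) q
  set R := pd 1 (pd 1 x) q
  set N := pd 0 (pd 0 (pd 1 x)) q
  set M := pd 1 (pd 0 (pd 1 x)) q
  have parseval (v w : E) : ip v w = -(ip v Y) * ip w X - ip v X * ip w Y - ip v m * ip w n
      - ip v n * ip w m := by
    conv_lhs => rw [hm v]
    simp only [ip_sub_left, ip_smul_left, ip_comm X w, ip_comm Y w, ip_comm n w, ip_comm m w]
  have pPP := parseval P P
  have pRR := parseval R R
  have pPR := parseval P R
  have pNN := parseval N N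
  have pMM := parseval M M
  simp only [h1, h2, h3, h4, h7, h8, h9, h10, h11, h12, h13] at pPP pRR pPR pNN pMM
  simp only [map_smul, map_add, pair_wedge, smul_eq_mul, ip_comm X N, ip_comm Y N, ip_comm X M,
    ip_comm Y M, ip_comm X P, ip_comm X R, ip_comm Y P, ip_comm Y R, ip_comm X n, ip_comm Y n,
    ip_comm Y X, ip_comm R P,
    hXX, hYY, hXY, h1, h2, h3, h4, h5, h6, h7, h8, h9, h10, h11, h12, h13] at e0 e1 e2 e3
  set b := ip P n
  set d := ip R n
  set a := ip P m
  set c := ip R m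
  -- If `b ≠ 0`, then `f0` gives `φ = 4ad`, so `d ≠ 0`, and `f1` gives `φ = 4bc`. By `f2` these are
  -- opposite, so `φ = 0`, a contradiction. If `b = 0`, then `f1` reads `d φ = 0`.
  have f0 : b * (φ q - 4 * (a * d)) = 0 := by
    linear_combination -e0 - e1 - φ q * d0 - 2 * pNN - 2 * d * pPP
  have f1 : d * (φ q - 4 * (b * c)) = 0 := by
    linear_combination e2 + e3 + φ q * d1 - 2 * pMM - 2 * b * pRR
  have f2 : a * d + b * c = 0 := by linarith
  by_cases hb : b = 0
  · refine ⟨hb, ?_⟩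
    rw [hb] at f1
    simpa [hp] using f1
  · exfalso
    have g0 : φ q = 4 * (a * d) := by
      have := (mul_eq_zero.1 f0).resolve_left hb; linarith
    have hd : d ≠ 0 := by rintro h0; rw [h0] at g0; simp [hp] at g0
    have g1 : φ q = 4 * (b * c) := by
      have := (mul_eq_zero.1 f1).resolve_left hd; linarith
    apply hp; linarith

/-- The surface lies locally in a degenerate hyperplane, over an affine null coordinate system. -/
theorem exists_affine {p : Plane} (hp : p ∈ S) : ∃ S' ⊆ S, IsOpen S' ∧ p ∈ S' ∧
    ∃ (η E₁ E₂ w : E) (k : Fin 4), η ≠ 0 ∧ ip η η = 0 ∧ ip η E₁ = 0 ∧ ip η E₂ = 0 ∧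
      ip E₁ E₁ = 0 ∧ ip E₂ E₂ = 0 ∧ ip E₁ E₂ = -1 ∧
      ∀ q ∈ S', x q = x q k • η + q.1 • E₁ + q.2 • E₂ + w := by
  -- A coordinate in which `n` does not vanish serves to normalize `n`, and later plays the role of
  -- `θ`.
  obtain ⟨k, hk⟩ : ∃ k, pd 0 (pd 1 x) p k ≠ 0 := by
    by_contra! h0
    exact hn p hp (by ext k; exact h0 k)
  let pr : E →L[ℝ] ℝ := EuclideanSpace.proj k
  have hcont : ContinuousAt (fun q => pr (pd 0 (pd 1 x) q)) p :=
    pr.continuous.continuousAt.comp (hx.smooth_pd_pd 0 1 hp).continuousAt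
  obtain ⟨ε, hε, hball⟩ := Metric.mem_nhds_iff.1
    (inter_mem (hx.isOpen.mem_nhds hp) (hcont.eventually_ne hk))
  set B := Metric.ball p ε
  have hBS : B ⊆ S := fun q hq => (hball hq).1
  have hpB : p ∈ B := Metric.mem_ball_self hε
  have hconst {f : Plane → E} (hf : ∀ q ∈ B, ContDiffAt ℝ ∞ f q)
      (h0 : ∀ q ∈ B, ∀ i, pd i f q = 0) : ∀ q ∈ B, f q = f p := fun q hq =>
    eq_of_pd_eq_zero Metric.isOpen_ball (convex_ball p ε) (fun q hq => dAt (hf q hq)) h0 hq hpB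
  have hr (q) (hq : q ∈ B) : pr (pd 0 (pd 1 x) q) ≠ 0 := (hball hq).2
  set n := pd 0 (pd 1 x) with hndef
  have sn (q) (hq : q ∈ B) : ContDiffAt ℝ ∞ n q := hx.smooth_pd_pd 0 1 (hBS hq)
  -- The tangent plane and `n` together have as orthogonal complement the line of `n`. The factor is
  -- measured by the `k`-th coordinate.
  have span (q) (hq : q ∈ B) : ∀ v : E, ip v (pd 0 x q) = 0 → ip v (pd 1 x q) = 0 →
      ip v (n q) = 0 → v = (pr v * (pr (n q))⁻¹) • n q := by
    obtain ⟨m, hm⟩ := hx.exists_transversal hnn hn (hBS hq)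
    intro v h1 h2 h3
    have hv := hm v
    rw [h1, h2, h3] at hv
    have hv' : v = -(ip v m) • n q := by
      rw [neg_smul]; simpa using hv
    have hpv : pr v = -(ip v m) * pr (n q) := by
      conv_lhs => rw [hv']
      simp
    rw [hpv, mul_assoc, mul_inv_cancel₀ (hr q hq), mul_one]
    exact hv'
  have second (q) (hq : q ∈ B) := hx.uu_n_vv_n hnn hn hφ hC (hBS hq)
  have spr (f : Plane → E) (q) (hf : ContDiffAt ℝ ∞ f q) : ContDiffAt ℝ ∞ (fun q => pr (f q)) q :=
    (pr.contDiff (n := ∞)).contDiffAt.comp q hf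
  have sinv (q) (hq : q ∈ B) : ContDiffAt ℝ ∞ (fun q => (pr (n q))⁻¹) q :=
    (spr n q (sn q hq)).inv (hr q hq)
  let η : E := (pr (n p))⁻¹ • n p
  -- Each derivative of `n` is orthogonal to `x_u`, `x_v` and `n`, hence a multiple of `n`, so the
  -- normalized direction has zero derivative.
  have hη : ∀ q ∈ B, (pr (n q))⁻¹ • n q = η := by
    apply hconst (f := fun q => (pr (n q))⁻¹ • n q) (fun q hq => (sinv q hq).smul (sn q hq))
    intro q hq i
    have hni : pd i n q = (pr (pd i n q) * (pr (n q))⁻¹) • n q := by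
      apply span q hq
      · have := second q hq
        fin_cases i
        · change ip (pd 0 n q) _ = 0
          rw [hx.nu_u (hBS hq), this.1, neg_zero]
        · exact hx.nv_u hnn (hBS hq)
      · have := second q hq
        fin_cases i
        · exact hx.nu_v hnn (hBS hq)
        · change ip (pd 1 n q) _ = 0
          rw [hx.nv_v (hBS hq), this.2, neg_zero]
      · exact hx.n_n hnn i (hBS hq)
    have hinv : pd i (fun q => (pr (n q))⁻¹) q = -(pr (pd i n q)) * ((pr (n q))⁻¹) ^ 2 := by
      have h1 : pd i (fun q => (pr (n q))⁻¹ * pr (n q)) q = 0 := by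
        rw [pd_congr (g := fun _ => (1 : ℝ)), pd_const]
        filter_upwards [Metric.isOpen_ball.mem_nhds hq] with q' hq'
        exact inv_mul_cancel₀ (hr q' hq')
      rw [pd_mul (dAt (sinv q hq)) (dAt (spr n q (sn q hq))), pd_clm pr (dAt (sn q hq))] at h1
      have := hr q hq
      field_simp at h1 ⊢
      linear_combination h1
    rw [pd_smul (dAt (sinv q hq)) (dAt (sn q hq)), hinv]
    nth_rewrite 2 [hni]
    module
  have span' (q) (hq : q ∈ B) (v : E) (h1 : ip v (pd 0 x q) = 0) (h2 : ip v (pd 1 x q) = 0)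
      (h3 : ip v (n q) = 0) : v = pr v • η := by
    rw [← hη q hq, smul_smul]; exact span q hq v h1 h2 h3
  have hder : ∀ q ∈ B, ∀ i j, pd i (pd j x) q = pr (pd i (pd j x) q) • η := by
    intro q hq i j
    have := second q hq
    fin_cases i <;> fin_cases j
    · exact span' q hq _ (hx.uu_u (hBS hq)) (hx.uu_v (hBS hq)) this.1
    · exact span' q hq _ (hx.uv_u (hBS hq)) (hx.uv_v (hBS hq)) (hnn q (hBS hq))
    · change pd 1 (pd 0 x) q = pr (pd 1 (pd 0 x) q) • η
      rw [hx.comm (hBS hq)]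
      exact span' q hq _ (hx.uv_u (hBS hq)) (hx.uv_v (hBS hq)) (hnn q (hBS hq))
    · exact span' q hq _ (hx.vv_u (hBS hq)) (hx.vv_v (hBS hq)) this.2
  have hsx (j) (q) (hq : q ∈ B) : ContDiffAt ℝ ∞ (pd j x) q := hx.smooth_pd j (hBS hq)
  have ssm (f : Plane → E) (q) (hf : ContDiffAt ℝ ∞ f q) :
      ContDiffAt ℝ ∞ (fun q => pr (f q) • η) q := (spr f q hf).smul contDiffAt_const
  have pdpr (f : Plane → E) (q) (hf : ContDiffAt ℝ ∞ f q) (i) :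
      pd i (fun q => f q - pr (f q) • η) q = pd i f q - pr (pd i f q) • η := by
    rw [pd_sub (dAt hf) (dAt (ssm f q hf)), pd_smul (dAt (spr f q hf)) (differentiableAt_const η),
      pd_const, pd_clm pr (dAt hf), smul_zero, add_zero]
  -- Since all second derivatives are multiples of `η`, removing the `η` component (measured by the
  -- `k`-th coordinate) from a first derivative leaves a constant.
  let F (j : Fin 2) : E := pd j x p - pr (pd j x p) • η
  have hF (j) : ∀ q ∈ B, pd j x q - pr (pd j x q) • η = F j := by
    apply hconst (f := fun q => pd j x q - pr (pd j x q) • η)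
      (fun q hq => (hsx j q hq).sub (ssm _ q (hsx j q hq)))
    intro q hq i
    rw [pdpr _ q (hsx j q hq), sub_eq_zero]
    exact hder q hq i j
  have hlin (q : Plane) : ContDiffAt ℝ ∞ (fun q : Plane => q.1 • F 0 + q.2 • F 1) q := by fun_prop
  have hfin : ∀ q ∈ B, (x q - pr (x q) • η) - (q.1 • F 0 + q.2 • F 1)
      = (x p - pr (x p) • η) - (p.1 • F 0 + p.2 • F 1) := by
    have sx (q) (hq : q ∈ B) := hx.smooth q (hBS hq)
    have s1 (q) (hq : q ∈ B) : ContDiffAt ℝ ∞ (fun q => x q - pr (x q) • η) q :=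
      (sx q hq).sub (ssm x q (sx q hq))
    apply hconst (f := fun q => (x q - pr (x q) • η) - (q.1 • F 0 + q.2 • F 1))
      (fun q hq => (s1 q hq).sub (hlin q))
    intro q hq i
    rw [pd_sub (dAt (s1 q hq)) (dAt (hlin q)), pdpr x q (sx q hq), hF i q hq, sub_eq_zero]
    let L : Plane →L[ℝ] E := (ContinuousLinearMap.fst ℝ ℝ ℝ).smulRight (F 0)
      + (ContinuousLinearMap.snd ℝ ℝ ℝ).smulRight (F 1)
    have hL : fderiv ℝ (fun q : Plane => q.1 • F 0 + q.2 • F 1) q = L := L.fderiv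
    unfold pd
    rw [hL]
    fin_cases i <;> simp [L]
  have hηz : η ≠ 0 := smul_ne_zero (inv_ne_zero (hr p hpB)) (hn p hp)
  have hηη : ip η η = 0 := by
    simp only [η, ip_smul_left, ip_smul_right, n, hnn p hp]; ring
  have hη0 : ip η (pd 0 x p) = 0 := by
    simp only [η, ip_smul_left, n, hx.uv_u hp]; ring
  have hη1 : ip η (pd 1 x p) = 0 := by
    simp only [η, ip_smul_left, n, hx.uv_v hp]; ring
  have h0η : ip (pd 0 x p) η = 0 := by rw [ip_comm]; exact hη0
  have h1η : ip (pd 1 x p) η = 0 := by rw [ip_comm]; exact hη1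
  refine ⟨B, hBS, Metric.isOpen_ball, hpB, η, F 0, F 1,
    (x p - pr (x p) • η) - (p.1 • F 0 + p.2 • F 1), k, hηz, hηη, ?_, ?_, ?_, ?_, ?_, ?_⟩
  · simp only [F, ip_sub_right, ip_smul_right, hη0, hηη]; ring
  · simp only [F, ip_sub_right, ip_smul_right, hη1, hηη]; ring
  · simp only [F, ip_sub_left, ip_sub_right, ip_smul_left, ip_smul_right, hη0, h0η, hηη,
      hx.uu p hp]; ring
  · simp only [F, ip_sub_left, ip_sub_right, ip_smul_left, ip_smul_right, hη1, h1η, hηη,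
      hx.vv p hp]; ring
  · simp only [F, ip_sub_left, ip_sub_right, ip_smul_left, ip_smul_right, h0η, hη1, hηη,
      hx.uv p hp]; ring
  · intro q hq
    rw [← hfin q hq]
    change x q = pr (x q) • η + _ + _ + _
    abel

end NullParam

end Rigidity

/-! ### The model surfaces -/

theorem sqrt_two_sq : Real.sqrt 2 * Real.sqrt 2 = 2 := Real.mul_self_sqrt (by norm_num)

theorem one_div_sqrt_two_sq : (1 / Real.sqrt 2) * (1 / Real.sqrt 2) = 1 / 2 := by
  rw [div_mul_div_comm, sqrt_two_sq, one_mul]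

theorem model_eq (θ : Plane → ℝ) (q : Plane) :
    model θ q = θ q • eta0 + q.1 • eta1 + q.2 • eta2 := by
  ext i
  fin_cases i <;> simp [model, eta0, eta1, eta2] <;> ring

theorem ip_eta00 : ip eta0 eta0 = 0 := by simp [ip, eta0]
theorem ip_eta01 : ip eta0 eta1 = 0 := by simp [ip, eta0, eta1]
theorem ip_eta02 : ip eta0 eta2 = 0 := by simp [ip, eta0, eta2]
theorem ip_eta11 : ip eta1 eta1 = 0 := by simp [ip, eta1]
theorem ip_eta22 : ip eta2 eta2 = 0 := by simp [ip, eta2]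
theorem ip_eta12 : ip eta1 eta2 = -1 := by
  have := one_div_sqrt_two_sq
  simp [ip, eta1, eta2] at this ⊢
  linarith

theorem eta0_ne_zero : eta0 ≠ 0 := by
  intro h
  have := congrArg (fun v : E => v 0) h
  simp [eta0] at this

/-- A case of Witt's theorem: both triples are completed by a null transversal to frames with the
same Gram matrix, and `A` carries one frame to the other. -/
theorem exists_isometry {η E₁ E₂ : E} (hη : η ≠ 0) (hηη : ip η η = 0) (hη1 : ip η E₁ = 0)
    (hη2 : ip η E₂ = 0) (h11 : ip E₁ E₁ = 0) (h22 : ip E₂ E₂ = 0) (h12 : ip E₁ E₂ = -1) :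
    ∃ A : E →ₗ[ℝ] E, (∀ a b, ip (A a) (A b) = ip a b) ∧
      A eta0 = η ∧ A eta1 = E₁ ∧ A eta2 = E₂ := by
  obtain ⟨m, hmm, hm1, hm2, hηm⟩ := exists_null_frame h11 h22 h12 hηη hη1 hη2 hη
  obtain ⟨e, hee, he1, he2, hηe⟩ := exists_null_frame ip_eta11 ip_eta22 ip_eta12 ip_eta00
    ip_eta01 ip_eta02 eta0_ne_zero
  have hex := null_frame_expand ip_eta11 ip_eta22 ip_eta12 ip_eta00 ip_eta01 ip_eta02 hee he1 he2
    hηe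
  let A : E →ₗ[ℝ] E := -((ipB.flip eta2).toLinearMap.smulRight E₁)
    - (ipB.flip eta1).toLinearMap.smulRight E₂ - (ipB.flip e).toLinearMap.smulRight η
    - (ipB.flip eta0).toLinearMap.smulRight m
  have hA (v : E) : A v = -(ip v eta2) • E₁ - (ip v eta1) • E₂ - (ip v e) • η
      - (ip v eta0) • m := by
    simp [A, ipB_apply]
  refine ⟨A, ?_, ?_, ?_, ?_⟩
  · intro a b
    have hab : ip a b = -(ip a eta2) * ip b eta1 - ip a eta1 * ip b eta2 - ip a e * ip b eta0
        - ip a eta0 * ip b e := by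
      conv_lhs => rw [hex a]
      simp only [ip_sub_left, ip_smul_left, ip_comm eta1 b, ip_comm eta2 b, ip_comm eta0 b,
        ip_comm e b]
    rw [hab, hA, hA]
    simp only [ip_sub_left, ip_smul_left, ip_sub_right, ip_smul_right, ip_comm E₁ η,
      ip_comm E₂ η, ip_comm E₂ E₁, ip_comm E₁ m, ip_comm E₂ m, ip_comm m η, h11, h22, h12, hηη,
      hη1, hη2, hmm, hm1, hm2, hηm]
    ring
  · rw [hA, ip_eta02, ip_eta01, ip_eta00, hηe]; simp
  · rw [hA, ip_eta12, ip_eta11, ip_comm eta1 e, he1, ip_comm eta1, ip_eta01]; simp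
  · rw [hA, ip_eta22, ip_comm eta2 eta1, ip_eta12, ip_comm eta2 e, he2, ip_comm eta2, ip_eta02]
    simp

/-! ### The Gauss equation -/

theorem contDiffAt_metric {z : Plane → E} {p : Plane} (hz : ContDiffAt ℝ ∞ z p) (i j : Fin 2) :
    ContDiffAt ℝ ∞ (fun q => metric z q i j) p :=
  contDiffAt_ip (contDiffAt_pd hz i) (contDiffAt_pd hz j)

theorem metric_symm (z : Plane → E) (p : Plane) (i j : Fin 2) :
    metric z p i j = metric z p j i := ip_comm _ _

theorem contDiffAt_metric_det {z : Plane → E} {p : Plane} (hz : ContDiffAt ℝ ∞ z p) :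
    ContDiffAt ℝ ∞ (fun q => (metric z q).det) p := by
  simp only [Matrix.det_fin_two]
  exact ((contDiffAt_metric hz 0 0).mul (contDiffAt_metric hz 1 1)).sub
    ((contDiffAt_metric hz 0 1).mul (contDiffAt_metric hz 1 0))

theorem contDiffAt_metric_inv {z : Plane → E} {p : Plane} (hz : ContDiffAt ℝ ∞ z p)
    (hd : (metric z p).det ≠ 0) (i j : Fin 2) :
    ContDiffAt ℝ ∞ (fun q => (metric z q)⁻¹ i j) p := by
  have hdet := (contDiffAt_metric_det hz).inv hd
  simp only [Matrix.inv_def, Ring.inverse_eq_inv', Matrix.smul_apply, Matrix.adjugate_fin_two,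
    smul_eq_mul]
  refine hdet.mul ?_
  fin_cases i <;> fin_cases j
  · exact contDiffAt_metric hz 1 1
  · exact (contDiffAt_metric hz 0 1).neg
  · exact (contDiffAt_metric hz 1 0).neg
  · exact contDiffAt_metric hz 0 0

theorem contDiffAt_christoffel {z : Plane → E} {p : Plane} (hz : ContDiffAt ℝ ∞ z p)
    (hd : (metric z p).det ≠ 0) (k i j : Fin 2) : ContDiffAt ℝ ∞ (christoffel z k i j) p :=
  ContDiffAt.sum fun l _ => (contDiffAt_metric_inv hz hd k l).mul
    (contDiffAt_ip (contDiffAt_pd (contDiffAt_pd hz j) i) (contDiffAt_pd hz l))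

/-- The Christoffel symbols solve the Gram system for the tangential part of a second derivative. In
this form they can be differentiated without touching the inverse metric. -/
theorem ip_pd_pd_eq {z : Plane → E} {p : Plane} (hd : (metric z p).det ≠ 0) (i j l : Fin 2) :
    ip (pd i (pd j z) p) (pd l z p) =
      christoffel z 0 i j p * metric z p 0 l + christoffel z 1 i j p * metric z p 1 l := by
  have s := metric_symm z p 1 0
  have hd' := hd
  rw [Matrix.det_fin_two, s] at hd'
  simp only [christoffel, Fin.sum_univ_two, Matrix.inv_def, Ring.inverse_eq_inv',
    Matrix.smul_apply, Matrix.adjugate_fin_two, smul_eq_mul, Matrix.of_apply, Matrix.cons_val',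
    Matrix.cons_val_zero, Matrix.cons_val_one, Matrix.cons_val_fin_one, Matrix.det_fin_two, s]
  revert l
  rw [Fin.forall_fin_two, s]
  set D := metric z p 0 0 * metric z p 1 1 - metric z p 0 1 * metric z p 0 1 with hD
  have hDi : D⁻¹ * D = 1 := inv_mul_cancel₀ hd'
  constructor
  · linear_combination (-ip (pd i (pd j z) p) (pd 0 z p)) * hDi
      + (ip (pd i (pd j z) p) (pd 0 z p)) * D⁻¹ * hD
  · linear_combination (-ip (pd i (pd j z) p) (pd 1 z p)) * hDi
      + (ip (pd i (pd j z) p) (pd 1 z p)) * D⁻¹ * hD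

theorem secondForm_eq (z : Plane → E) (i j : Fin 2) (p : Plane) :
    secondForm z i j p = pd i (pd j z) p - (christoffel z 0 i j p • pd 0 z p
      + christoffel z 1 i j p • pd 1 z p) := by
  rw [secondForm, Fin.sum_univ_two]

theorem ip_secondForm_pd {z : Plane → E} {p : Plane} (hd : (metric z p).det ≠ 0) (i j l : Fin 2) :
    ip (secondForm z i j p) (pd l z p) = 0 := by
  rw [secondForm_eq, ip_sub_left, ip_add_left, ip_smul_left, ip_smul_left, ip_pd_pd_eq hd]
  simp only [metric, Matrix.of_apply]
  ring

/-- Differentiating `ip_pd_pd_eq` for `⟨z₁₁, z₀⟩` along 0 and for `⟨z₀₁, z₀⟩` along 1 and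
subtracting cancels the third derivatives. What remains is the curvature component plus products of
second fundamental forms. -/
theorem gauss_equation {z : Plane → E} {p : Plane} (hz : ContDiffAt ℝ ∞ z p)
    (hd : (metric z p).det ≠ 0) (hK : gaussCurv z p = 0) :
    ip (secondForm z 1 1 p) (pd 0 (pd 0 z) p) = ip (secondForm z 0 1 p) (pd 0 (pd 1 z) p) := by
  have hev : ∀ᶠ q in 𝓝 p, (metric z q).det ≠ 0 :=
    (contDiffAt_metric_det hz).continuousAt.eventually_ne hd
  have sz (i) := dAt (contDiffAt_pd hz i)
  have szz (i j) := dAt (contDiffAt_pd (contDiffAt_pd hz j) i)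
  have sΓ (k i j) := dAt (contDiffAt_christoffel hz hd k i j)
  have sg (i j) : DifferentiableAt ℝ (fun q => metric z q i j) p := dAt (contDiffAt_metric hz i j)
  have dg (a i j) : pd a (fun q => metric z q i j) p
      = ip (pd a (pd i z) p) (pd j z p) + ip (pd i z p) (pd a (pd j z) p) := pd_ip (sz i) (sz j) a
  have main (a i j l) : ip (pd a (pd i (pd j z)) p) (pd l z p)
      + ip (pd i (pd j z) p) (pd a (pd l z) p)
      = pd a (christoffel z 0 i j) p * metric z p 0 l
        + christoffel z 0 i j p * (ip (pd a (pd 0 z) p) (pd l z p)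
          + ip (pd 0 z p) (pd a (pd l z) p))
        + (pd a (christoffel z 1 i j) p * metric z p 1 l
        + christoffel z 1 i j p * (ip (pd a (pd 1 z) p) (pd l z p)
          + ip (pd 1 z p) (pd a (pd l z) p))) := by
    rw [← pd_ip (szz i j) (sz l), ← dg, ← dg, ← pd_mul (sΓ 0 i j) (sg 0 l),
      ← pd_mul (sΓ 1 i j) (sg 1 l),
      ← pd_add ((sΓ 0 i j).fun_mul (sg 0 l)) ((sΓ 1 i j).fun_mul (sg 1 l))]
    exact pd_congr (hev.mono fun q hq => ip_pd_pd_eq hq i j l) a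
  have m0 := main 0 1 1 0
  have m1 := main 1 0 1 0
  rw [pd_comm (contDiffAt_pd hz 1) 1 0, pd_comm hz 1 0] at m1
  rw [gaussCurv, div_eq_zero_iff, or_iff_left hd] at hK
  simp only [riemann, Fin.sum_univ_two] at hK
  have a0 := ip_pd_pd_eq hd 0 0 0
  have a1 := ip_pd_pd_eq hd 0 1 0
  have a2 := ip_pd_pd_eq hd 1 1 0
  have c0 : christoffel z 0 1 0 p = christoffel z 0 0 1 p := by
    simp only [christoffel, pd_comm hz 1 0]
  have c1 : christoffel z 1 1 0 p = christoffel z 1 0 1 p := by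
    simp only [christoffel, pd_comm hz 1 0]
  have s := metric_symm z p 0 1
  rw [c0, c1, s] at hK
  rw [secondForm_eq, secondForm_eq]
  simp only [ip_sub_left, ip_add_left, ip_smul_left]
  rw [a0, a1] at m0
  rw [a1, a2] at m1
  linear_combination m0 - m1 + hK

/-! ### Local inverses and primitives -/

/-- The Poincaré lemma in the plane. -/
theorem exists_primitive {B : Set Plane} (hB : IsOpen B) (hc : Convex ℝ B) {a b : Plane → ℝ}
    (ha : ∀ q ∈ B, ContDiffAt ℝ ∞ a q) (hb : ∀ q ∈ B, ContDiffAt ℝ ∞ b q)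
    (hab : ∀ q ∈ B, pd 1 a q = pd 0 b q) :
    ∃ f : Plane → ℝ, ∀ q ∈ B, ContDiffAt ℝ ∞ f q ∧ pd 0 f q = a q ∧ pd 1 f q = b q := by
  let dx : Plane →L[ℝ] ℝ := ContinuousLinearMap.fst ℝ ℝ ℝ
  let dy : Plane →L[ℝ] ℝ := ContinuousLinearMap.snd ℝ ℝ ℝ
  let τ : Plane → Plane →L[ℝ] ℝ := fun q => a q • dx + b q • dy
  have hτ : ∀ q ∈ B, ContDiffAt ℝ ∞ τ q := fun q hq =>
    ((ha q hq).smul contDiffAt_const).add ((hb q hq).smul contDiffAt_const)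
  have hτ' : ∀ q ∈ B, ∀ v, fderiv ℝ τ q v = (fderiv ℝ a q v) • dx + (fderiv ℝ b q v) • dy := by
    intro q hq v
    have h1 := ((dAt (ha q hq)).hasFDerivAt.smul_const dx).add
      ((dAt (hb q hq)).hasFDerivAt.smul_const dy)
    rw [show fderiv ℝ τ q = _ from h1.fderiv]
    simp
  obtain ⟨f, hf⟩ := hc.exists_forall_hasFDerivAt_of_fderiv_symmetric hB
    (fun q hq => (dAt (hτ q hq)).differentiableWithinAt) (fun q hq v w => by
      rw [hτ' q hq, hτ' q hq, fderiv_apply_eq_pd a, fderiv_apply_eq_pd a, fderiv_apply_eq_pd b,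
        fderiv_apply_eq_pd b, hab q hq]
      simp [dx, dy]
      ring)
  have hsm : ContDiffOn ℝ ∞ f B := by
    rw [contDiffOn_infty_iff_fderiv_of_isOpen hB]
    refine ⟨fun q hq => (hf q hq).differentiableAt.differentiableWithinAt, ?_⟩
    refine ContDiffOn.congr (f := τ) (fun q hq => (hτ q hq).contDiffWithinAt) ?_
    exact fun q hq => (hf q hq).fderiv
  refine ⟨f, fun q hq => ⟨hsm.contDiffAt (hB.mem_nhds hq), ?_, ?_⟩⟩
  · rw [pd_zero_eq, (hf q hq).fderiv]; simp [τ, dx, dy]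
  · rw [pd_one_eq, (hf q hq).fderiv]; simp [τ, dx, dy]

theorem jac_comp {k h : Plane → Plane} {q : Plane} (hk : DifferentiableAt ℝ k (h q))
    (hh : DifferentiableAt ℝ h q) : jac (fun q => k (h q)) q = jac k (h q) * jac h q := by
  have e1 (a) := pd_comp (f := fun q => (k q).1) hk.fst hh a
  have e2 (a) := pd_comp (f := fun q => (k q).2) hk.snd hh a
  ext i j
  fin_cases i <;> fin_cases j <;> simp [jac, Matrix.mul_apply, Fin.sum_univ_two, e1, e2] <;> ring

theorem jac_id (q : Plane) : jac (fun q => q) q = 1 := by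
  have e1 : fderiv ℝ (fun q : Plane => q.1) q = ContinuousLinearMap.fst ℝ ℝ ℝ := fderiv_fst
  have e2 : fderiv ℝ (fun q : Plane => q.2) q = ContinuousLinearMap.snd ℝ ℝ ℝ := fderiv_snd
  ext i j
  fin_cases i <;> fin_cases j <;> simp [jac, pd, e1, e2]

/-- The inverse function theorem in the plane. -/
theorem exists_chart {k : Plane → Plane} {B : Set Plane} (hB : IsOpen B)
    (hk : ∀ q ∈ B, ContDiffAt ℝ ∞ k q) (hJ : ∀ q ∈ B, (jac k q).det ≠ 0) {p : Plane} (hp : p ∈ B) :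
    ∃ e : OpenPartialHomeomorph Plane Plane, p ∈ e.source ∧ e.source ⊆ B ∧ (∀ q, e q = k q) ∧
      ∀ y ∈ e.target, ContDiffAt ℝ ∞ e.symm y := by
  have hder : ∀ q ∈ B, ∃ L : Plane ≃L[ℝ] Plane, HasFDerivAt k (L : Plane →L[ℝ] Plane) q := by
    intro q hq
    have hd : (fderiv ℝ k q).det ≠ 0 := by rw [det_jac (dAt (hk q hq))]; exact hJ q hq
    refine ⟨(fderiv ℝ k q).toContinuousLinearEquivOfDetNeZero hd, ?_⟩
    rw [ContinuousLinearMap.coe_toContinuousLinearEquivOfDetNeZero]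
    exact (dAt (hk q hq)).hasFDerivAt
  obtain ⟨L, hL⟩ := hder p hp
  let e₀ := (hk p hp).toOpenPartialHomeomorph k hL (by simp)
  have he₀ : ∀ q, e₀ q = k q := fun q => rfl
  -- Restricting to `B` keeps the derivative invertible throughout, so the inverse is smooth on its
  -- whole domain and not only at the image of `p`.
  refine ⟨e₀.restrOpen B hB, ?_, ?_, he₀, ?_⟩
  · exact ⟨(hk p hp).mem_toOpenPartialHomeomorph_source hL (by simp), hp⟩
  · exact fun q hq => hq.2
  · intro y hy
    have hyB : (e₀.restrOpen B hB).symm y ∈ B := ((e₀.restrOpen B hB).map_target hy).2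
    obtain ⟨L', hL'⟩ := hder _ hyB
    exact (e₀.restrOpen B hB).contDiffAt_symm hy hL' (hk _ hyB)

/-! ### Flat null coordinates -/

/-- The field `ξ ∂₀z - ∂₁z` is to be null. The root is taken as `g₁₁/(g₀₁ + r)` with `r² = -det g`,
which remains valid where `g₀₀ = 0`. The last conclusion is transversality to `∂₀z`, with value
`-r`. -/
theorem exists_null_direction {z : Plane → E} {D : Set Plane} (hD : IsOpen D)
    (hz : ∀ q ∈ D, ContDiffAt ℝ ∞ z q) (hdet : ∀ q ∈ D, (metric z q).det < 0)
    {p : Plane} (hp : p ∈ D) :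
    ∃ ε > 0, Metric.ball p ε ⊆ D ∧ ∃ ξ : Plane → ℝ, ∀ q ∈ Metric.ball p ε, ContDiffAt ℝ ∞ ξ q ∧
      metric z q 0 0 * ξ q ^ 2 - 2 * metric z q 0 1 * ξ q + metric z q 1 1 = 0 ∧
      metric z q 0 0 * ξ q - metric z q 0 1 ≠ 0 := by
  -- The sign of `r` is chosen to agree with `g₀₁` at `p`, so that the denominator cannot vanish
  -- there.
  obtain ⟨s, hs2, hs⟩ : ∃ s : ℝ, s * s = 1 ∧ 0 ≤ s * metric z p 0 1 := by
    rcases le_total 0 (metric z p 0 1) with h | h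
    · exact ⟨1, by norm_num, by linarith⟩
    · exact ⟨-1, by norm_num, by linarith⟩
  let r : Plane → ℝ := fun q => s * Real.sqrt (-(metric z q).det)
  let w : Plane → ℝ := fun q => metric z q 0 1 + r q
  have hr2 (q) (hq : q ∈ D) : r q * r q
      = metric z q 0 1 * metric z q 0 1 - metric z q 0 0 * metric z q 1 1 := by
    have := Real.mul_self_sqrt (neg_pos.2 (hdet q hq)).le
    have h1 := metric_symm z q 1 0
    have h2 := Matrix.det_fin_two (metric z q)
    rw [h1] at h2
    simp only [r]
    linear_combination (Real.sqrt (-(metric z q).det)) ^ 2 * hs2 + this - h2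
  have hr0 (q) (hq : q ∈ D) : r q ≠ 0 :=
    mul_ne_zero (by rintro rfl; simp at hs2) (Real.sqrt_pos.2 (neg_pos.2 (hdet q hq))).ne'
  have hrs (q) (hq : q ∈ D) : ContDiffAt ℝ ∞ r q :=
    contDiffAt_const.mul ((contDiffAt_metric_det (hz q hq)).neg.sqrt (neg_pos.2 (hdet q hq)).ne')
  have hws (q) (hq : q ∈ D) : ContDiffAt ℝ ∞ w q := (contDiffAt_metric (hz q hq) 0 1).add (hrs q hq)
  have hwp : w p ≠ 0 := by
    have h1 : 0 < s * w p := by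
      have : s * w p = s * metric z p 0 1 + (s * s) * Real.sqrt (-(metric z p).det) := by
        simp only [w, r]; ring
      rw [this, hs2]
      have := Real.sqrt_pos.2 (neg_pos.2 (hdet p hp))
      linarith
    exact fun h0 => by simp [h0] at h1
  obtain ⟨ε, hε, hball⟩ := Metric.mem_nhds_iff.1
    (inter_mem (hD.mem_nhds hp) ((hws p hp).continuousAt.eventually_ne hwp))
  refine ⟨ε, hε, fun q hq => (hball hq).1, fun q => metric z q 1 1 / w q, fun q hq => ?_⟩
  have hqD := (hball hq).1
  have hw0 : w q ≠ 0 := (hball hq).2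
  have h2 := hr2 q hqD
  have hwq : w q = metric z q 0 1 + r q := rfl
  refine ⟨(contDiffAt_metric (hz q hqD) 1 1).div (hws q hqD) hw0, ?_, ?_⟩
  · field_simp
    rw [hwq]
    linear_combination metric z q 1 1 * h2
  · have : metric z q 0 0 * (metric z q 1 1 / w q) - metric z q 0 1 = -r q := by
      field_simp
      rw [hwq]
      linear_combination h2
    rw [this]
    exact neg_ne_zero.2 (hr0 q hqD)

/-- A null tangent field which is parallel, i.e. whose derivatives are normal to the surface. -/
theorem exists_parallel {z : Plane → E} {B : Set Plane} (hB : IsOpen B) (hc : Convex ℝ B)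
    (hz : ∀ q ∈ B, ContDiffAt ℝ ∞ z q) (hdet : ∀ q ∈ B, (metric z q).det < 0)
    (hK : ∀ q ∈ B, gaussCurv z q = 0) {ξ : Plane → ℝ} (hξ : ∀ q ∈ B, ContDiffAt ℝ ∞ ξ q)
    (hnull : ∀ q ∈ B, metric z q 0 0 * ξ q ^ 2 - 2 * metric z q 0 1 * ξ q + metric z q 1 1 = 0)
    (hne : ∀ q ∈ B, metric z q 0 0 * ξ q - metric z q 0 1 ≠ 0) :
    ∃ μ : Plane → ℝ, (∀ q ∈ B, ContDiffAt ℝ ∞ μ q ∧ μ q ≠ 0) ∧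
      ∀ q ∈ B, ∀ i j, ip (pd i (fun q => μ q • (ξ q • pd 0 z q - pd 1 z q)) q) (pd j z q) = 0 := by
  let X : Plane → E := fun q => ξ q • pd 0 z q - pd 1 z q
  have sz (i) (q) (hq : q ∈ B) : ContDiffAt ℝ ∞ (pd i z) q := contDiffAt_pd (hz q hq) i
  have sX (q) (hq : q ∈ B) : ContDiffAt ℝ ∞ X q := ((hξ q hq).smul (sz 0 q hq)).sub (sz 1 q hq)
  have hXX (q) (hq : q ∈ B) : ip (X q) (X q) = 0 := by
    rw [← hnull q hq]
    simp only [X, ip_sub_left, ip_sub_right, ip_smul_left, ip_smul_right, metric, Matrix.of_apply,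
      ip_comm (pd 1 z q) (pd 0 z q)]
    ring
  let P : Plane → ℝ := fun q => ip (X q) (pd 0 z q)
  have hP (q) (hq : q ∈ B) : P q ≠ 0 := by
    have := hne q hq
    simpa only [P, X, ip_sub_left, ip_smul_left, metric, Matrix.of_apply,
      ip_comm (pd 1 z q) (pd 0 z q), mul_comm] using this
  have sP (q) (hq : q ∈ B) : ContDiffAt ℝ ∞ P q := contDiffAt_ip (sX q hq) (sz 0 q hq)
  -- The connection form of the null line field: the tangential part of `∂ᵢX` is orthogonal to the
  -- null field `X`, hence equals `lᵢ X`.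
  let l (i : Fin 2) : Plane → ℝ := fun q => ip (pd i X q) (pd 0 z q) / P q
  have sl (i) (q) (hq : q ∈ B) : ContDiffAt ℝ ∞ (l i) q :=
    (contDiffAt_ip (contDiffAt_pd (sX q hq) i) (sz 0 q hq)).div (sP q hq) (hP q hq)
  have hl (i) (q) (hq : q ∈ B) : l i q * P q = ip (pd i X q) (pd 0 z q) :=
    div_mul_cancel₀ _ (hP q hq)
  have hXd (i) (q) (hq : q ∈ B) : ip (pd i X q) (X q) = 0 := by
    have := pd_ip_of_const hB hq (sX q hq) (sX q hq) hXX i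
    rw [ip_comm (X q)] at this
    linarith
  have normal (i j) (q) (hq : q ∈ B) : ip (pd i X q - l i q • X q) (pd j z q) = 0 := by
    have h0 : ip (pd i X q - l i q • X q) (pd 0 z q) = 0 := by
      rw [ip_sub_left, ip_smul_left, ← hl i q hq, sub_self]
    have h1 : ip (pd i X q - l i q • X q) (X q) = 0 := by
      rw [ip_sub_left, ip_smul_left, hXd i q hq, hXX q hq]; ring
    have e : pd 1 z q = ξ q • pd 0 z q - X q := by simp only [X]; abel
    fin_cases j
    · exact h0
    · change ip _ (pd 1 z q) = 0
      rw [e, ip_sub_right, ip_smul_right, h0, h1]; ring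
  -- The differential of the connection form is the curvature. The extrinsic terms left over are
  -- removed by the Gauss equation.
  have hclosed : ∀ q ∈ B, pd 1 (l 0) q = pd 0 (l 1) q := by
    intro q hq
    have hd := (hdet q hq).ne
    have der (a i) : pd a (l i) q * P q + l i q * (ip (pd a X q) (pd 0 z q)
        + ip (X q) (pd a (pd 0 z) q))
        = ip (pd a (pd i X) q) (pd 0 z q) + ip (pd i X q) (pd a (pd 0 z) q) := by
      have e1 : pd a P q = ip (pd a X q) (pd 0 z q) + ip (X q) (pd a (pd 0 z) q) :=
        pd_ip (dAt (sX q hq)) (dAt (sz 0 q hq)) a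
      rw [← pd_ip (dAt (contDiffAt_pd (sX q hq) i)) (dAt (sz 0 q hq)), ← e1,
        ← pd_mul (dAt (sl i q hq)) (dAt (sP q hq))]
      apply pd_congr
      filter_upwards [hB.mem_nhds hq] with q' hq'
      exact hl i q' hq'
    have d01 := der 0 1
    have d10 := der 1 0
    rw [pd_comm (sX q hq) 0 1, ← hl 0 q hq] at d01
    rw [← hl 1 q hq, pd_comm (hz q hq) 1 0] at d10
    have gauss := gauss_equation (hz q hq) hd (hK q hq)
    have hX' (i) : pd i X q = pd i ξ q • pd 0 z q + ξ q • pd i (pd 0 z) q - pd i (pd 1 z) q := by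
      simp only [X]
      have sξz : DifferentiableAt ℝ (fun q => ξ q • pd 0 z q) q :=
        dAt ((hξ q hq).smul (sz 0 q hq))
      rw [pd_sub sξz (dAt (sz 1 q hq)), pd_smul (dAt (hξ q hq)) (dAt (sz 0 q hq))]
    have tt (i j k m : Fin 2) : ip (secondForm z i j q) (pd k (pd m z) q)
        = ip (secondForm z i j q) (secondForm z k m q) := by
      rw [secondForm_eq z k m, ip_sub_right, ip_add_right, ip_smul_right, ip_smul_right,
        ip_secondForm_pd hd, ip_secondForm_pd hd]; ring
    have nn (i j k : Fin 2) : ip (pd k X q) (pd i (pd j z) q) - l k q * ip (X q) (pd i (pd j z) q)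
        = ξ q * ip (secondForm z i j q) (secondForm z k 0 q)
          - ip (secondForm z i j q) (secondForm z k 1 q) := by
      have h1 : ip (pd k X q - l k q • X q) (pd i (pd j z) q)
          = ip (pd k X q - l k q • X q) (secondForm z i j q) := by
        rw [secondForm_eq, ip_sub_right, ip_add_right, ip_smul_right, ip_smul_right,
          normal k 0 q hq, normal k 1 q hq]; ring
      rw [← ip_smul_left, ← ip_sub_left, h1, hX', ip_comm, ← tt, ← tt]
      simp only [X, ip_sub_right, ip_add_right, ip_smul_right, ip_secondForm_pd hd]
      ring
    have n0 := nn 0 1 0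
    have n1 := nn 0 0 1
    have s10 : secondForm z 1 0 q = secondForm z 0 1 q := by
      simp only [secondForm_eq, christoffel, pd_comm (hz q hq) 1 0]
    rw [tt, tt, ip_comm] at gauss
    rw [s10, ip_comm (secondForm z 0 0 q) (secondForm z 0 1 q)] at n1
    apply mul_right_cancel₀ (hP q hq)
    linear_combination d10 - d01 + n0 - n1 + gauss
  -- Rescaling by `exp f` adds `df` to the connection form, so `df = -l` makes the field parallel.
  obtain ⟨f, hf⟩ := exists_primitive hB hc (fun q hq => (sl 0 q hq).neg)
    (fun q hq => (sl 1 q hq).neg) (fun q hq => by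
      have h (i a) : pd a (fun q => -l i q) q = -pd a (l i) q := by
        unfold pd; rw [fderiv_fun_neg]; rfl
      rw [h, h, hclosed q hq])
  have hfi (i) (q) (hq : q ∈ B) : pd i f q = -l i q := by
    fin_cases i
    exacts [(hf q hq).2.1, (hf q hq).2.2]
  refine ⟨fun q => Real.exp (f q), fun q hq => ⟨(hf q hq).1.exp, (Real.exp_pos _).ne'⟩, ?_⟩
  intro q hq i j
  have he : pd i (fun q => Real.exp (f q)) q = Real.exp (f q) * pd i f q := by
    unfold pd; rw [fderiv_exp (dAt (hf q hq).1)]; rfl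
  rw [pd_smul (dAt (hf q hq).1.exp) (dAt (sX q hq)), he, hfi i q hq]
  have := normal i j q hq
  rw [ip_sub_left, ip_smul_left] at this
  rw [ip_add_left, ip_smul_left, ip_smul_left]
  linear_combination Real.exp (f q) * this

/-- The covector metrically dual to a parallel field is closed. -/
theorem exists_primitive_of_parallel {z X : Plane → E} {B : Set Plane} (hB : IsOpen B)
    (hc : Convex ℝ B) (hz : ∀ q ∈ B, ContDiffAt ℝ ∞ z q) (hX : ∀ q ∈ B, ContDiffAt ℝ ∞ X q)
    (hpar : ∀ q ∈ B, ∀ i j, ip (pd i X q) (pd j z q) = 0) :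
    ∃ s : Plane → ℝ, ∀ q ∈ B, ContDiffAt ℝ ∞ s q ∧ ∀ j, pd j s q = ip (X q) (pd j z q) := by
  have sz (i) (q) (hq : q ∈ B) : ContDiffAt ℝ ∞ (pd i z) q := contDiffAt_pd (hz q hq) i
  obtain ⟨s, hs⟩ := exists_primitive hB hc (fun q hq => contDiffAt_ip (hX q hq) (sz 0 q hq))
    (fun q hq => contDiffAt_ip (hX q hq) (sz 1 q hq)) (fun q hq => by
      rw [pd_ip (dAt (hX q hq)) (dAt (sz 0 q hq)), pd_ip (dAt (hX q hq)) (dAt (sz 1 q hq)),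
        hpar q hq, hpar q hq, pd_comm (hz q hq) 1 0])
  exact ⟨s, fun q hq => ⟨(hs q hq).1, Fin.forall_fin_two.2 (hs q hq).2⟩⟩

/-- A parallel null field `X` and its null partner `Y` with `⟨X, Y⟩ = -1` have closed dual forms
`ds` and `dt`, and the metric is `-2 ds dt`. The map `h` is the inverse of the chart `(s, t)`. -/
theorem exists_null_coordinates {z : Plane → E} {D : Set Plane} (hD : IsOpen D)
    (hz : ∀ q ∈ D, ContDiffAt ℝ ∞ z q) (hdet : ∀ q ∈ D, (metric z q).det < 0)
    (hK : ∀ q ∈ D, gaussCurv z q = 0) {p : Plane} (hp : p ∈ D) :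
    ∃ h : OpenPartialHomeomorph Plane Plane, p ∈ h.target ∧ h.target ⊆ D ∧
      (∀ q ∈ h.source, ContDiffAt ℝ ∞ h q) ∧ (∀ y ∈ h.target, ContDiffAt ℝ ∞ h.symm y) ∧
      NullParam (fun q => z (h q)) h.source := by
  obtain ⟨ε, hε, hBD, ξ, hξ⟩ := exists_null_direction hD hz hdet hp
  set B := Metric.ball p ε
  have hB : IsOpen B := Metric.isOpen_ball
  have hp' : p ∈ B := Metric.mem_ball_self hε
  have hc : Convex ℝ B := convex_ball p ε
  have hz' (q) (hq : q ∈ B) := hz q (hBD hq)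
  have sz (i) (q) (hq : q ∈ B) : ContDiffAt ℝ ∞ (pd i z) q := contDiffAt_pd (hz' q hq) i
  obtain ⟨μ, hμ, hpar⟩ := exists_parallel hB hc hz' (fun q hq => hdet q (hBD hq))
    (fun q hq => hK q (hBD hq)) (fun q hq => (hξ q hq).1) (fun q hq => (hξ q hq).2.1)
    (fun q hq => (hξ q hq).2.2)
  set X : Plane → E := fun q => μ q • (ξ q • pd 0 z q - pd 1 z q) with hXdef
  have sX (q) (hq : q ∈ B) : ContDiffAt ℝ ∞ X q :=
    (hμ q hq).1.smul (((hξ q hq).1.smul (sz 0 q hq)).sub (sz 1 q hq))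
  let P : Plane → ℝ := fun q => ip (pd 0 z q) (X q)
  have sP (q) (hq : q ∈ B) : ContDiffAt ℝ ∞ P q := contDiffAt_ip (sz 0 q hq) (sX q hq)
  have hP (q) (hq : q ∈ B) : P q ≠ 0 := by
    have := mul_ne_zero (hμ q hq).2 (hξ q hq).2.2
    simp only [metric, Matrix.of_apply] at this
    simp only [P, X, ip_sub_right, ip_smul_right]
    rwa [mul_comm (ξ q)]
  have hXX (q) (hq : q ∈ B) : ip (X q) (X q) = 0 := by
    have := (hξ q hq).2.1
    simp only [metric, Matrix.of_apply] at this
    simp only [X, ip_sub_left, ip_sub_right, ip_smul_left, ip_smul_right,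
      ip_comm (pd 1 z q) (pd 0 z q)]
    linear_combination μ q ^ 2 * this
  let c : Plane → ℝ := fun q => -(P q)⁻¹
  have sc (q) (hq : q ∈ B) : ContDiffAt ℝ ∞ c q := ((sP q hq).inv (hP q hq)).neg
  have hcP (q) (hq : q ∈ B) : c q * P q = -1 := by
    simp only [c]; rw [neg_mul, inv_mul_cancel₀ (hP q hq)]
  -- With `c P = -1`, the square of `c ∂₀z + b X` is `c² g₀₀ - 2b`, and this choice of `b` makes it
  -- zero.
  let b : Plane → ℝ := fun q => c q ^ 2 * metric z q 0 0 / 2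
  have sb (q) (hq : q ∈ B) : ContDiffAt ℝ ∞ b q :=
    (((sc q hq).pow 2).mul (contDiffAt_metric (hz' q hq) 0 0)).div_const 2
  let Y : Plane → E := fun q => c q • pd 0 z q + b q • X q
  have sY (q) (hq : q ∈ B) : ContDiffAt ℝ ∞ Y q :=
    ((sc q hq).smul (sz 0 q hq)).add ((sb q hq).smul (sX q hq))
  have hYX (q) (hq : q ∈ B) : ip (Y q) (X q) = -1 := by
    simp only [Y, ip_add_left, ip_smul_left, hXX q hq]
    linear_combination hcP q hq
  have hYY (q) (hq : q ∈ B) : ip (Y q) (Y q) = 0 := by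
    have e : ip (Y q) (Y q) = c q * ip (pd 0 z q) (Y q) + b q * ip (X q) (Y q) := by
      conv_lhs => rw [show Y q = c q • pd 0 z q + b q • X q from rfl, ip_add_left,
        ip_smul_left, ip_smul_left]
    rw [e, ip_comm (X q), hYX q hq]
    simp only [Y, ip_add_right, ip_smul_right]
    rw [show ip (pd 0 z q) (X q) = P q from rfl,
      show ip (pd 0 z q) (pd 0 z q) = metric z q 0 0 from rfl]
    simp only [b]
    linear_combination c q ^ 2 * metric z q 0 0 / 2 * hcP q hq
  -- the coordinate fields in the null frame
  have span0 (q) (hq : q ∈ B) : pd 0 z q = (c q)⁻¹ • (Y q - b q • X q) := by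
    have hc0 : c q ≠ 0 := neg_ne_zero.2 (inv_ne_zero (hP q hq))
    simp only [Y]
    rw [add_sub_cancel_right, smul_smul, inv_mul_cancel₀ hc0, one_smul]
  have span1 (q) (hq : q ∈ B) : pd 1 z q = ξ q • pd 0 z q - (μ q)⁻¹ • X q := by
    rw [hXdef]
    simp only
    rw [smul_smul, inv_mul_cancel₀ (hμ q hq).2, one_smul, sub_sub_cancel]
  have span (q) (hq : q ∈ B) (i) : pd i z q = -(ip (pd i z q) (Y q)) • X q
      - (ip (pd i z q) (X q)) • Y q := by
    have lin : ∃ s t : ℝ, pd i z q = s • X q + t • Y q := by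
      fin_cases i
      · exact ⟨-((c q)⁻¹ * b q), (c q)⁻¹, (span0 q hq).trans (by module)⟩
      · refine ⟨-(ξ q * ((c q)⁻¹ * b q)) - (μ q)⁻¹, ξ q * (c q)⁻¹, (span1 q hq).trans ?_⟩
        rw [span0 q hq]
        module
    obtain ⟨s, t, hst⟩ := lin
    have e1 : ip (pd i z q) (Y q) = -s := by
      rw [hst, ip_add_left, ip_smul_left s, ip_smul_left t, hYY q hq, ip_comm, hYX q hq]; ring
    have e2 : ip (pd i z q) (X q) = -t := by
      rw [hst, ip_add_left, ip_smul_left s, ip_smul_left t, hXX q hq, hYX q hq]; ring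
    rw [e1, e2]
    nth_rewrite 1 [hst]
    module
  -- `Y` is automatically parallel: the products `⟨Y, Y⟩` and `⟨Y, X⟩` are constant and `X` is
  -- parallel, so derivatives of `Y` are orthogonal to both `X` and `Y`.
  have hparY : ∀ q ∈ B, ∀ i j, ip (pd i Y q) (pd j z q) = 0 := by
    intro q hq i j
    have h1 : ip (pd i Y q) (Y q) = 0 := by
      have := pd_ip_of_const hB hq (sY q hq) (sY q hq) hYY i
      rw [ip_comm (Y q)] at this
      linarith
    have h2 : ip (pd i Y q) (X q) = 0 := by
      have := pd_ip_of_const hB hq (sY q hq) (sX q hq) hYX i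
      rw [ip_comm (Y q)] at this
      have h3 : ip (pd i X q) (Y q) = 0 := by
        simp only [Y, ip_add_right, ip_smul_right, hpar q hq i 0]
        simp only [hXdef, ip_sub_right, ip_smul_right]
        rw [hpar q hq i 0, hpar q hq i 1]
        ring
      linarith
    rw [span q hq j, ip_sub_right, ip_smul_right (-ip (pd j z q) (Y q)),
      ip_smul_right (ip (pd j z q) (X q)), h1, h2]
    ring
  obtain ⟨s, hs⟩ := exists_primitive_of_parallel hB hc hz' sX hpar
  obtain ⟨t, ht⟩ := exists_primitive_of_parallel hB hc hz' sY hparY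
  let k : Plane → Plane := fun q => (s q, t q)
  have hk (q) (hq : q ∈ B) : ContDiffAt ℝ ∞ k q := (hs q hq).1.prodMk (ht q hq).1
  have hfact (q) (hq : q ∈ B) :
      (jac k q).transpose * !![0, -1; -1, 0] * jac k q = metric z q := by
    have gij (i j) : metric z q i j
        = -(ip (X q) (pd i z q) * ip (Y q) (pd j z q) + ip (Y q) (pd i z q) * ip (X q) (pd j z q)) := by
      change ip (pd i z q) (pd j z q) = _
      nth_rewrite 1 [span q hq i]
      simp only [ip_sub_left, ip_smul_left, ip_comm (pd i z q)]
      ring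
    have hj : jac k q = !![ip (X q) (pd 0 z q), ip (X q) (pd 1 z q);
        ip (Y q) (pd 0 z q), ip (Y q) (pd 1 z q)] := by
      simp only [jac, k]
      rw [← (hs q hq).2 0, ← (hs q hq).2 1, ← (ht q hq).2 0, ← (ht q hq).2 1]
    ext i j
    rw [gij, hj]
    fin_cases i <;> fin_cases j <;> simp [Matrix.mul_apply, Fin.sum_univ_two]
  have hJ (q) (hq : q ∈ B) : (jac k q).det ≠ 0 := by
    intro h0
    have := congrArg Matrix.det (hfact q hq)
    rw [Matrix.det_mul, h0, mul_zero] at this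
    exact (hdet q (hBD hq)).ne this.symm
  obtain ⟨e, hpe, heB, hek, hes⟩ := exists_chart hB hk hJ hp'
  have hsmooth (y) (hy : y ∈ e.symm.target) : ContDiffAt ℝ ∞ e.symm.symm y := by
    rw [OpenPartialHomeomorph.symm_symm]
    exact (hk y (heB hy)).congr_of_eventuallyEq (Eventually.of_forall hek)
  -- The factorization `g = Kᵀ N K`, with `K` the Jacobian of the chart, is undone by the Jacobian
  -- of its inverse.
  have hmet (q) (hq : q ∈ e.target) : metric (fun q => z (e.symm q)) q = !![0, -1; -1, 0] := by
    have hqB := heB (e.map_target hq)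
    have h1 := metric_comp (z := z) (h := e.symm) (dAt (hz' _ hqB)) (dAt (hes q hq))
    have h2 := jac_comp (k := k) (h := e.symm) (dAt (hk _ hqB)) (dAt (hes q hq))
    have h3 : jac (fun q => k (e.symm q)) q = 1 := by
      rw [← jac_id q]
      have : (fun q => k (e.symm q)) =ᶠ[𝓝 q] fun q => q := by
        filter_upwards [e.open_target.mem_nhds hq] with q' hq'
        rw [← hek]
        exact e.right_inv hq'
      have c1 (a) := pd_congr (this.fun_comp Prod.fst) a
      have c2 (a) := pd_congr (this.fun_comp Prod.snd) a
      simp only [Function.comp_def] at c1 c2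
      simp only [jac, c1, c2]
    rw [h3] at h2
    rw [← h1, ← hfact _ hqB]
    have h4 := congrArg Matrix.transpose h2
    rw [Matrix.transpose_one, Matrix.transpose_mul] at h4
    rw [Matrix.mul_assoc, Matrix.mul_assoc, Matrix.mul_assoc, ← h2, ← Matrix.mul_assoc, ← h4]
    simp
  have hms (q) (hq : q ∈ e.target) (i j) := congrFun (congrFun (hmet q hq) i) j
  exact ⟨e.symm, hpe, fun q hq => hBD (heB hq), hes, hsmooth, e.open_target,
    fun q hq => (hz' _ (heB (e.map_target hq))).comp q (hes q hq),
    fun q hq => hms q hq 0 0, fun q hq => hms q hq 1 1, fun q hq => hms q hq 0 1⟩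

/-! ### The Gauss map in null coordinates -/

theorem contDiffAt_gaussMap {z : Plane → E} {p : Plane} (hz : ContDiffAt ℝ ∞ z p)
    (hd : (metric z p).det < 0) : ContDiffAt ℝ ∞ (gaussMap z) p :=
  (((contDiffAt_metric_det hz).neg.sqrt (neg_pos.2 hd).ne').inv
    (Real.sqrt_pos.2 (neg_pos.2 hd)).ne').smul
    (contDiffAt_wedge (contDiffAt_pd hz 0) (contDiffAt_pd hz 1))

/-- Beltrami's formula. It turns the coordinate formula for the Laplacian into one for `H`. -/
theorem meanCurv_eq_laplacian (z : Plane → E) (p : Plane) :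
    meanCurv z p = -((1 / 2 : ℝ) • laplacian z z p) := by
  rw [laplacian, smul_neg, neg_neg]
  rfl

section NullCoordinates

variable {z : Plane → E} {h : Plane → Plane} {S : Set Plane}
  (hx : NullParam (fun q => z (h q)) S) (hz : ∀ q ∈ S, ContDiffAt ℝ ∞ z (h q))
  (hh : ∀ q ∈ S, ContDiffAt ℝ ∞ h q)
include hx hz hh

theorem metric_det_neg {q : Plane} (hq : q ∈ S) : (metric z (h q)).det < 0 := by
  have := det_metric_comp hx hq (hz q hq) (hh q hq)
  by_contra! h0
  nlinarith [mul_nonneg (sq_nonneg (jac h q).det) h0]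

theorem meanCurv_comp {q : Plane} (hq : q ∈ S) :
    meanCurv z (h q) = -pd 0 (pd 1 (fun q => z (h q))) q := by
  rw [meanCurv_eq_laplacian, laplacian_comp hx hq (hz q hq) (hh q hq) (hz q hq), smul_smul]
  norm_num

theorem exists_orientation {p : Plane} (hp : p ∈ S) :
    ∃ σ : ℝ, (σ = 1 ∨ σ = -1) ∧ ∃ S' ⊆ S, IsOpen S' ∧ p ∈ S' ∧
      ∀ q ∈ S', 0 < σ * (jac h q).det := by
  have hd := det_metric_comp hx hp (hz p hp) (hh p hp)
  have hcont : ContinuousAt (fun q => (jac h q).det) p := by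
    simp only [jac, Matrix.det_fin_two_of]
    have h1 (a) : ContinuousAt (pd a fun q => (h q).1) p :=
      (contDiffAt_pd (hh p hp).fst a).continuousAt
    have h2 (a) : ContinuousAt (pd a fun q => (h q).2) p :=
      (contDiffAt_pd (hh p hp).snd a).continuousAt
    exact ((h1 0).mul (h2 1)).sub ((h1 1).mul (h2 0))
  obtain ⟨σ, hσ, hpos⟩ : ∃ σ : ℝ, (σ = 1 ∨ σ = -1) ∧ 0 < σ * (jac h p).det := by
    rcases lt_trichotomy (jac h p).det 0 with h0 | h0 | h0
    · exact ⟨-1, Or.inr rfl, by linarith⟩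
    · rw [h0] at hd; norm_num at hd
    · exact ⟨1, Or.inl rfl, by linarith⟩
  have hev : ∀ᶠ q in 𝓝 p, 0 < σ * (jac h q).det :=
    (continuousAt_const.mul hcont).eventually (lt_mem_nhds hpos)
  obtain ⟨S', hS', ho, hp'⟩ := mem_nhds_iff.1 (inter_mem (hx.isOpen.mem_nhds hp) hev)
  exact ⟨σ, hσ, S', fun q hq => (hS' hq).1, ho, hp', fun q hq => (hS' hq).2⟩

theorem laplacian_gaussMap_comp {σ : ℝ} (hσ : σ = 1 ∨ σ = -1)
    (hdet : ∀ q ∈ S, 0 < σ * (jac h q).det) {q : Plane} (hq : q ∈ S) :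
    laplacian z (gaussMap z) (h q) = (2 * σ) • pd 0 (pd 1 (fun q =>
      wedge (pd 0 (fun q => z (h q)) q) (pd 1 (fun q => z (h q)) q))) q := by
  rw [laplacian_comp hx hq (hz q hq) (hh q hq)
    (contDiffAt_gaussMap (hz q hq) (metric_det_neg hx hz hh hq))]
  have sw (q) (hq : q ∈ S) : ContDiffAt ℝ ∞ (fun q =>
      wedge (pd 0 (fun q => z (h q)) q) (pd 1 (fun q => z (h q)) q)) q :=
    contDiffAt_wedge (hx.smooth_pd 0 hq) (hx.smooth_pd 1 hq)
  have e1 : (fun q => gaussMap z (h q)) =ᶠ[𝓝 q] fun q =>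
      σ • wedge (pd 0 (fun q => z (h q)) q) (pd 1 (fun q => z (h q)) q) := by
    filter_upwards [hx.isOpen.mem_nhds hq] with q' hq'
    exact gaussMap_comp hx hq' (hz q' hq') (hh q' hq') hσ (hdet q' hq')
  have e2 : pd 1 (fun q => gaussMap z (h q)) =ᶠ[𝓝 q] fun q => σ • pd 1 (fun q =>
      wedge (pd 0 (fun q => z (h q)) q) (pd 1 (fun q => z (h q)) q)) q := by
    filter_upwards [pd_congr_nhds e1 1, hx.isOpen.mem_nhds hq] with q' h1 hq'
    rw [h1, pd_const_smul σ (dAt (sw q' hq'))]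
  rw [pd_congr e2, pd_const_smul σ (dAt (contDiffAt_pd (sw q hq) 1)), smul_smul]

end NullCoordinates

theorem CongruentVia.restr {y z : Plane → E} {A : E →ₗ[ℝ] E} {w : E}
    {h : OpenPartialHomeomorph Plane Plane} (hc : CongruentVia y z A w h) {S : Set Plane}
    (hS : IsOpen S) : CongruentVia y z A w (h.restrOpen S hS) :=
  ⟨hc.1, hc.2.1.mono fun _ hq => hq.1, hc.2.2.1.mono fun _ hq => hq.1,
    fun q hq => hc.2.2.2 q hq.1⟩

/-- A flat quasi-minimal surface with pointwise 1-type Gauss map is locally a model surface. -/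
theorem exists_model {z : Plane → E} {D : Set Plane} (hL : IsLorentzSurface z D) (hK : IsFlat z D)
    (hH : IsQuasiMinimal z D) {p : Plane} {U : Set Plane} (hU : IsOpen U) (hp : p ∈ U)
    (hUD : U ⊆ D) (h1 : HasPointwiseOneType z U) :
    ∃ (h : OpenPartialHomeomorph Plane Plane) (A : E →ₗ[ℝ] E) (w : E) (θ : Plane → ℝ),
      p ∈ h.target ∧ h.target ⊆ U ∧ ContDiffOn ℝ ∞ θ h.source ∧ CongruentVia (model θ) z A w h := by
  have hz (q) (hq : q ∈ U) : ContDiffAt ℝ ∞ z q := hL.2.1.contDiffAt (hL.1.mem_nhds (hUD hq))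
  obtain ⟨h, hph, hhU, hhs, hhi, hx⟩ := exists_null_coordinates hU hz
    (fun q hq => hL.2.2 q (hUD hq)) (fun q hq => hK q (hUD hq)) hp
  have hzh (q) (hq : q ∈ h.source) : ContDiffAt ℝ ∞ z (h q) := hz _ (hhU (h.map_source hq))
  obtain ⟨σ, hσ, S, hSh, hS, hpS, hdet⟩ := exists_orientation hx hzh hhs (h.map_target hph)
  have hxS := hx.mono hSh hS
  have hσ2 : σ * σ = 1 := by rcases hσ with rfl | rfl <;> norm_num
  obtain ⟨φ, C, ⟨-, hφC⟩, hφ⟩ := h1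
  have hn (q) (hq : q ∈ S) := hH (h q) (hUD (hhU (h.map_source (hSh hq))))
  have hmc (q) (hq : q ∈ S) := meanCurv_comp hx hzh hhs (hSh hq)
  have hnn (q) (hq : q ∈ S) : ip (pd 0 (pd 1 (fun q => z (h q))) q)
      (pd 0 (pd 1 (fun q => z (h q))) q) = 0 := by
    have := (hn q hq).2
    rwa [hmc q hq, ip_neg_left, ip_neg_right, neg_neg] at this
  have hn0 (q) (hq : q ∈ S) : pd 0 (pd 1 (fun q => z (h q))) q ≠ 0 := by
    have := (hn q hq).1
    rwa [hmc q hq, neg_ne_zero] at this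
  -- Multiplying by `σ`, with `σ² = 1`, moves the orientation sign from the Gauss map to the
  -- constant bivector.
  have heq (q) (hq : q ∈ S) : (2 : ℝ) • pd 0 (pd 1 (fun q =>
      wedge (pd 0 (fun q => z (h q)) q) (pd 1 (fun q => z (h q)) q))) q
      = φ (h q) • (wedge (pd 0 (fun q => z (h q)) q) (pd 1 (fun q => z (h q)) q) + σ • C) := by
    have e := hφC (h q) (hhU (h.map_source (hSh hq)))
    rw [laplacian_gaussMap_comp hxS (fun q hq => hzh q (hSh hq)) (fun q hq => hhs q (hSh hq)) hσ
      hdet hq, gaussMap_comp hxS hq (hzh q (hSh hq)) (hhs q (hSh hq)) hσ (hdet q hq)] at e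
    have e' := congrArg (fun v => σ • v) e
    simp only [smul_smul, smul_add] at e'
    rw [show σ * (2 * σ) = 2 by linear_combination 2 * hσ2,
      show σ * (φ (h q) * σ) = φ (h q) by linear_combination φ (h q) * hσ2, mul_comm σ] at e'
    rw [e', smul_add, smul_smul]
  obtain ⟨S', hS'S, hS', hpS', η, E₁, E₂, w, k, hη, hηη, hη1, hη2, h11, h22, h12, hxe⟩ :=
    hxS.exists_affine hnn hn0 (φ := fun q => φ (h q))
      (fun q hq => hφ (h q) (hhU (h.map_source (hSh hq)))) heq hpS
  obtain ⟨A, hA, hA0, hA1, hA2⟩ := exists_isometry hη hηη hη1 hη2 h11 h22 h12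
  refine ⟨h.restrOpen S' hS', A, w, fun q => z (h q) k, ⟨hph, hpS'⟩, fun q hq => hhU hq.1,
    ?_, hA, ?_, ?_, ?_⟩
  · intro q hq
    exact ((EuclideanSpace.proj (𝕜 := ℝ) k).contDiff.contDiffAt.comp q
      (hx.smooth q hq.1)).contDiffWithinAt
  · exact fun q hq => (hhs q hq.1).contDiffWithinAt
  · exact fun q hq => (hhi q hq.1).contDiffWithinAt
  · intro q hq
    change z (h q) = _
    rw [model_eq, map_add, map_add, map_smul, map_smul, map_smul, hA0, hA1, hA2]
    exact hxe q hq.2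

/-! ### The Gauss map of the model surfaces -/

section Model

variable {z : Plane → E} {h : Plane → Plane} {S : Set Plane} {A : E →ₗ[ℝ] E} {w : E}
  {θ : Plane → ℝ} (hS : IsOpen S) (hθ : ∀ q ∈ S, ContDiffAt ℝ ∞ θ q)
  (hc : ∀ q ∈ S, z (h q) = A (model θ q) + w)
include hS hθ hc

theorem pd_model (i : Fin 2) {q : Plane} (hq : q ∈ S) :
    pd i (fun q => z (h q)) q = pd i θ q • A eta0 + A (![eta1, eta2] i) := by
  have ev : (fun q => z (h q)) =ᶠ[𝓝 q] fun q => θ q • A eta0 + (q.1 • A eta1 + q.2 • A eta2 + w) := by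
    filter_upwards [hS.mem_nhds hq] with q' hq'
    rw [hc q' hq', model_eq, map_add, map_add, map_smul, map_smul, map_smul]
    abel
  have hθq := dAt (hθ q hq)
  have hs : DifferentiableAt ℝ (fun q => θ q • A eta0) q := hθq.smul_const _
  have hl : HasFDerivAt (fun q : Plane => q.1 • A eta1 + q.2 • A eta2 + w)
      ((ContinuousLinearMap.fst ℝ ℝ ℝ).smulRight (A eta1)
        + (ContinuousLinearMap.snd ℝ ℝ ℝ).smulRight (A eta2)) q :=
    (((ContinuousLinearMap.fst ℝ ℝ ℝ).smulRight (A eta1)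
        + (ContinuousLinearMap.snd ℝ ℝ ℝ).smulRight (A eta2)).hasFDerivAt).add_const w
  rw [pd_congr ev, pd_add hs hl.differentiableAt, pd_smul hθq (differentiableAt_const _), pd_const,
    smul_zero, add_zero]
  congr 1
  unfold pd
  rw [hl.fderiv]
  fin_cases i <;> simp

theorem pd_pd_model (i j : Fin 2) {q : Plane} (hq : q ∈ S) :
    pd i (pd j (fun q => z (h q))) q = pd i (pd j θ) q • A eta0 := by
  have ev : pd j (fun q => z (h q)) =ᶠ[𝓝 q] fun q => pd j θ q • A eta0 + A (![eta1, eta2] j) := by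
    filter_upwards [hS.mem_nhds hq] with q' hq'
    exact pd_model hS hθ hc j hq'
  have hd := dAt (contDiffAt_pd (hθ q hq) j)
  have hs : DifferentiableAt ℝ (fun q => pd j θ q • A eta0) q := hd.smul_const _
  rw [pd_congr ev, pd_add hs (differentiableAt_const _), pd_smul hd (differentiableAt_const _),
    pd_const, pd_const, smul_zero, add_zero, add_zero]

theorem pd_pd_pd_model (i j k : Fin 2) {q : Plane} (hq : q ∈ S) :
    pd i (pd j (pd k (fun q => z (h q)))) q = pd i (pd j (pd k θ)) q • A eta0 := by
  have ev : pd j (pd k (fun q => z (h q))) =ᶠ[𝓝 q] fun q => pd j (pd k θ) q • A eta0 := by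
    filter_upwards [hS.mem_nhds hq] with q' hq'
    exact pd_pd_model hS hθ hc j k hq'
  have hd := dAt (contDiffAt_pd (contDiffAt_pd (hθ q hq) k) j)
  rw [pd_congr ev, pd_smul hd (differentiableAt_const _), pd_const, smul_zero, add_zero]

theorem wedge_model {q : Plane} (hq : q ∈ S) :
    wedge (pd 0 (fun q => z (h q)) q) (pd 1 (fun q => z (h q)) q)
      = pd 0 θ q • wedge (A eta0) (A eta2) - pd 1 θ q • wedge (A eta0) (A eta1)
        + wedge (A eta1) (A eta2) := by
  rw [pd_model hS hθ hc 0 hq, pd_model hS hθ hc 1 hq]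
  simp only [Matrix.cons_val_zero, Matrix.cons_val_one, wedge_add_left, wedge_add_right,
    wedge_smul_left, wedge_smul_right, wedge_self, wedge_swap (A eta0) (A eta1)]
  module

variable (hA : ∀ a b, ip (A a) (A b) = ip a b) (hz : ∀ q ∈ S, ContDiffAt ℝ ∞ z (h q))
  (hh : ∀ q ∈ S, ContDiffAt ℝ ∞ h q)
include hA hz hh

/-- `η₀` is null and orthogonal to `η₁` and `η₂`, so `θ` does not enter the induced metric. -/
theorem nullParam_model : NullParam (fun q => z (h q)) S := by
  refine ⟨hS, fun q hq => (hz q hq).comp q (hh q hq), ?_, ?_, ?_⟩ <;> intro q hq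
  · rw [pd_model hS hθ hc 0 hq]
    simp only [Matrix.cons_val_zero, ip_add_left, ip_add_right, ip_smul_left, ip_smul_right, hA,
      ip_comm eta1 eta0, ip_eta00, ip_eta01, ip_eta11]
    ring
  · rw [pd_model hS hθ hc 1 hq]
    simp only [Matrix.cons_val_one, ip_add_left, ip_add_right, ip_smul_left, ip_smul_right, hA,
      Matrix.cons_val_zero, ip_comm eta2 eta0, ip_eta00, ip_eta02, ip_eta22]
    ring
  · rw [pd_model hS hθ hc 0 hq, pd_model hS hθ hc 1 hq]
    simp only [Matrix.cons_val_one, Matrix.cons_val_zero, ip_add_left, ip_add_right, ip_smul_left,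
      ip_smul_right, hA, ip_comm eta1 eta0, ip_eta00, ip_eta01, ip_eta02, ip_eta12]
    ring

theorem gaussMap_model {σ : ℝ} (hσ : σ = 1 ∨ σ = -1) (hdet : ∀ q ∈ S, 0 < σ * (jac h q).det)
    {q : Plane} (hq : q ∈ S) :
    gaussMap z (h q) = σ • (pd 0 θ q • wedge (A eta0) (A eta2)
      - pd 1 θ q • wedge (A eta0) (A eta1) + wedge (A eta1) (A eta2)) := by
  rw [gaussMap_comp (nullParam_model hS hθ hc hA hz hh) hq (hz q hq) (hh q hq) hσ (hdet q hq),
    wedge_model hS hθ hc hq]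

/-- All second derivatives of the surface are multiples of `A η₀`, so the term `x_uu ∧ x_vv` drops
out, as does the `A η₀` part of the first derivatives in the other two terms. -/
theorem laplacian_gaussMap_model {σ : ℝ} (hσ : σ = 1 ∨ σ = -1)
    (hdet : ∀ q ∈ S, 0 < σ * (jac h q).det) {q : Plane} (hq : q ∈ S) :
    laplacian z (gaussMap z) (h q) = (2 * σ) •
      (pd 0 (pd 0 (pd 1 θ)) q • wedge (A eta0) (A eta2)
        - pd 1 (pd 0 (pd 1 θ)) q • wedge (A eta0) (A eta1)) := by
  have hx := nullParam_model hS hθ hc hA hz hh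
  rw [laplacian_gaussMap_comp hx hz hh hσ hdet hq, hx.pd_pd_wedge hq,
    pd_pd_pd_model hS hθ hc _ _ _ hq, pd_pd_pd_model hS hθ hc _ _ _ hq,
    pd_pd_model hS hθ hc _ _ hq, pd_pd_model hS hθ hc _ _ hq, pd_model hS hθ hc 0 hq,
    pd_model hS hθ hc 1 hq]
  simp only [Matrix.cons_val_zero, Matrix.cons_val_one, wedge_add_left, wedge_add_right,
    wedge_smul_left, wedge_smul_right, wedge_self, wedge_swap (A eta0) (A eta1)]
  module

end Model

theorem modelC_ne_zero (c₁ c₂ : ℝ) : modelC c₁ c₂ ≠ 0 := by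
  intro h0
  -- Every bivector containing `η₀` is orthogonal to `η₁ ∧ η₂`, so this pairing isolates the last
  -- term.
  have := congrArg (pair eta1 eta2) h0
  simp only [modelC, map_sub, map_smul, pair_wedge, ip_eta01, ip_eta02, ip_eta11, ip_eta22,
    ip_eta12, ip_comm eta2 eta1, smul_eq_mul, map_zero] at this
  norm_num at this

/-! ### Functional dependence -/

/-- With `(ψ, m)` as local coordinates, the differential of `L` has no `m` component, so `L` depends
on `ψ` alone on a coordinate box. -/
theorem exists_comp_of_pd_eq_of_det {L ψ κ m : Plane → ℝ} {S : Set Plane} (hS : IsOpen S)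
    (hL : ∀ q ∈ S, ContDiffAt ℝ ∞ L q) (hψ : ∀ q ∈ S, ContDiffAt ℝ ∞ ψ q)
    (hm : ∀ q ∈ S, ContDiffAt ℝ ∞ m q) (hκ : ∀ q ∈ S, ∀ i, pd i L q = κ q * pd i ψ q)
    {p : Plane} (hp : p ∈ S) (hdet : (jac (fun q => (ψ q, m q)) p).det ≠ 0) :
    ∃ V ⊆ S, IsOpen V ∧ p ∈ V ∧ ∃ (F : ℝ → ℝ) (J : Set ℝ), IsOpen J ∧ ContDiffOn ℝ ∞ F J ∧
      ∀ q ∈ V, ψ q ∈ J ∧ L q = F (ψ q) := by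
  set k : Plane → Plane := fun q => (ψ q, m q) with hkdef
  have hk (q) (hq : q ∈ S) : ContDiffAt ℝ ∞ k q := (hψ q hq).prodMk (hm q hq)
  have hcont : ContinuousAt (fun q => (jac k q).det) p := by
    simp only [jac, Matrix.det_fin_two_of]
    have h1 (a) : ContinuousAt (pd a fun q => (k q).1) p :=
      (contDiffAt_pd (hk p hp).fst a).continuousAt
    have h2 (a) : ContinuousAt (pd a fun q => (k q).2) p :=
      (contDiffAt_pd (hk p hp).snd a).continuousAt
    exact ((h1 0).mul (h2 1)).sub ((h1 1).mul (h2 0))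
  obtain ⟨B, hBS, hB, hpB⟩ := mem_nhds_iff.1
    (inter_mem (hS.mem_nhds hp) (hcont.eventually_ne hdet))
  obtain ⟨e, hpe, heB, hek, hes⟩ := exists_chart hB (fun q hq => hk q (hBS hq).1)
    (fun q hq => (hBS hq).2) hpB
  have hmem (y) (hy : y ∈ e.target) : e.symm y ∈ S := (hBS (heB (e.map_target hy))).1
  let Λ : Plane → ℝ := fun y => L (e.symm y)
  have sΛ (y) (hy : y ∈ e.target) : ContDiffAt ℝ ∞ Λ y := (hL _ (hmem y hy)).comp y (hes y hy)
  have hΛ (y) (hy : y ∈ e.target) : pd 1 Λ y = 0 := by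
    have ev : (fun y => ψ (e.symm y)) =ᶠ[𝓝 y] fun y => y.1 := by
      filter_upwards [e.open_target.mem_nhds hy] with y' hy'
      have := e.right_inv hy'
      rw [hek] at this
      exact congrArg Prod.fst this
    have e1 : pd 1 (fun y : Plane => y.1) y = 0 := by
      have : fderiv ℝ (fun q : Plane => q.1) y = ContinuousLinearMap.fst ℝ ℝ ℝ := fderiv_fst
      rw [pd_one_eq, this]; rfl
    have e2 := pd_congr ev 1
    rw [e1, pd_comp (dAt (hψ _ (hmem y hy))) (dAt (hes y hy))] at e2
    simp only [Λ]
    rw [pd_comp (dAt (hL _ (hmem y hy))) (dAt (hes y hy)), hκ _ (hmem y hy), hκ _ (hmem y hy)]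
    simp only [smul_eq_mul] at e2 ⊢
    linear_combination κ (e.symm y) * e2
  obtain ⟨ε, hε, hball⟩ := Metric.mem_nhds_iff.1 (e.open_target.mem_nhds (e.map_source hpe))
  -- The sup norm makes balls of the plane into products, so the segments along the second
  -- coordinate stay inside.
  have hprod : Metric.ball (e p) ε = Metric.ball (e p).1 ε ×ˢ Metric.ball (e p).2 ε :=
    (ball_prod_same _ _ _).symm
  have hin (a b : ℝ) (ha : a ∈ Metric.ball (e p).1 ε) (hb : b ∈ Metric.ball (e p).2 ε) :
      (a, b) ∈ e.target := hball (by rw [hprod]; exact ⟨ha, hb⟩)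
  refine ⟨e.source ∩ e ⁻¹' Metric.ball (e p) ε, fun q hq => (hBS (heB hq.1)).1,
    e.isOpen_inter_preimage Metric.isOpen_ball, ⟨hpe, Metric.mem_ball_self hε⟩,
    fun a => Λ (a, (e p).2), Metric.ball (e p).1 ε, Metric.isOpen_ball, ?_, ?_⟩
  · intro a ha
    have := sΛ _ (hin a _ ha (Metric.mem_ball_self hε))
    exact (this.comp a (contDiffAt_id.prodMk contDiffAt_const)).contDiffWithinAt
  · intro q hq
    have hq2 : e q ∈ Metric.ball (e p).1 ε ×ˢ Metric.ball (e p).2 ε := by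
      rw [← hprod]; exact hq.2
    have hψq : (e q).1 = ψ q := by rw [hek]
    refine ⟨hψq ▸ hq2.1, ?_⟩
    have hder (b : ℝ) (hb : b ∈ Metric.ball (e p).2 ε) :
        HasDerivAt (fun b => Λ ((e q).1, b)) 0 b := by
      have h1 := (dAt (sΛ _ (hin _ b hq2.1 hb))).hasFDerivAt
      have h2 : HasDerivAt (fun b : ℝ => ((e q).1, b)) ((0 : ℝ), (1 : ℝ)) b :=
        (hasDerivAt_const b (e q).1).prodMk (hasDerivAt_id b)
      have h3 := h1.comp_hasDerivAt b h2
      rwa [← pd_one_eq, hΛ _ (hin _ b hq2.1 hb)] at h3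
    have hconst := Metric.isOpen_ball.is_const_of_deriv_eq_zero
      (convex_ball (e p).2 ε).isPreconnected
      (fun b hb => (hder b hb).differentiableAt.differentiableWithinAt)
      (fun b hb => (hder b hb).deriv) hq2.2 (Metric.mem_ball_self hε)
    rw [← hψq]
    refine Eq.trans ?_ hconst
    simp only [Λ]
    rw [Prod.mk.eta, e.left_inv hq.1]

/-- A function whose differential is a multiple of the nowhere zero differential of `ψ` is locally
a function of `ψ`. -/
theorem exists_comp_of_pd_eq {L ψ κ : Plane → ℝ} {S : Set Plane} (hS : IsOpen S)
    (hL : ∀ q ∈ S, ContDiffAt ℝ ∞ L q) (hψ : ∀ q ∈ S, ContDiffAt ℝ ∞ ψ q)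
    (hκ : ∀ q ∈ S, ∀ i, pd i L q = κ q * pd i ψ q)
    {p : Plane} (hp : p ∈ S) (hne : pd 0 ψ p ≠ 0 ∨ pd 1 ψ p ≠ 0) :
    ∃ V ⊆ S, IsOpen V ∧ p ∈ V ∧ ∃ (F : ℝ → ℝ) (J : Set ℝ), IsOpen J ∧ ContDiffOn ℝ ∞ F J ∧
      ∀ q ∈ V, ψ q ∈ J ∧ L q = F (ψ q) := by
  have e1 : fderiv ℝ (fun q : Plane => q.1) p = ContinuousLinearMap.fst ℝ ℝ ℝ := fderiv_fst
  have e2 : fderiv ℝ (fun q : Plane => q.2) p = ContinuousLinearMap.snd ℝ ℝ ℝ := fderiv_snd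
  rcases hne with h0 | h0
  · refine exists_comp_of_pd_eq_of_det (m := fun q => q.2) hS hL hψ
      (fun _ _ => contDiffAt_snd) hκ hp ?_
    simpa [jac, Matrix.det_fin_two_of, pd_zero_eq, pd_one_eq, e2] using h0
  · refine exists_comp_of_pd_eq_of_det (m := fun q => q.1) hS hL hψ
      (fun _ _ => contDiffAt_fst) hκ hp ?_
    simpa [jac, Matrix.det_fin_two_of, pd_zero_eq, pd_one_eq, e1] using h0

/-! ### Surfaces over solutions of the model equation -/

theorem pd_psi {θ : Plane → ℝ} {q : Plane} (hθ : DifferentiableAt ℝ θ q) (c₁ c₂ : ℝ) (i : Fin 2) :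
    pd i (psi θ c₁ c₂) q = pd i θ q + ![c₁, c₂] i := by
  have h1 : HasFDerivAt (fun q : Plane => c₁ * q.1) (c₁ • ContinuousLinearMap.fst ℝ ℝ ℝ) q :=
    (c₁ • ContinuousLinearMap.fst ℝ ℝ ℝ).hasFDerivAt
  have h2 : HasFDerivAt (fun q : Plane => c₂ * q.2) (c₂ • ContinuousLinearMap.snd ℝ ℝ ℝ) q :=
    (c₂ • ContinuousLinearMap.snd ℝ ℝ ℝ).hasFDerivAt
  have h3 : HasFDerivAt (psi θ c₁ c₂) _ q := (hθ.hasFDerivAt.add h1).add h2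
  unfold pd
  rw [h3.fderiv]
  fin_cases i <;> simp

theorem contDiffAt_psi {θ : Plane → ℝ} {q : Plane} (hθ : ContDiffAt ℝ ∞ θ q) (c₁ c₂ : ℝ) :
    ContDiffAt ℝ ∞ (psi θ c₁ c₂) q :=
  (hθ.add (contDiffAt_const.mul contDiffAt_fst)).add (contDiffAt_const.mul contDiffAt_snd)

section

variable {z : Plane → E} {D : Set Plane} (hL : IsLorentzSurface z D)
  {h : OpenPartialHomeomorph Plane Plane} {A : E →ₗ[ℝ] E} {w : E} {θ : Plane → ℝ}
  (hhD : h.target ⊆ D) (hθ : ContDiffOn ℝ ∞ θ h.source) (hc : CongruentVia (model θ) z A w h)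

include hL hhD in
theorem IsLorentzSurface.contDiffAt_chart {q : Plane} (hq : q ∈ h.source) :
    ContDiffAt ℝ ∞ z (h q) :=
  hL.2.1.contDiffAt (hL.1.mem_nhds (hhD (h.map_source hq)))

include hc in
theorem CongruentVia.contDiffAt {q : Plane} (hq : q ∈ h.source) : ContDiffAt ℝ ∞ h q :=
  hc.2.1.contDiffAt (h.open_source.mem_nhds hq)

include hL hhD hθ hc

theorem CongruentVia.nullParam : NullParam (fun q => z (h q)) h.source :=
  nullParam_model h.open_source (fun _ hq => hθ.contDiffAt (h.open_source.mem_nhds hq)) hc.2.2.2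
    hc.1 (fun _ hq => hL.contDiffAt_chart hhD hq) (fun _ hq => hc.contDiffAt hq)

theorem gaussMapEq_of_congruent {F : ℝ → ℝ} {J : Set ℝ} {c₁ c₂ σ : ℝ} (hJ : IsOpen J)
    (hmaps : MapsTo (psi θ c₁ c₂) h.source J) (hF : ContDiffOn ℝ ∞ F J)
    (heq : ∀ q ∈ h.source, pd 0 (pd 1 θ) q = F (psi θ c₁ c₂ q)) (hσ : σ = 1 ∨ σ = -1)
    (hdet : ∀ q ∈ h.source, 0 < σ * (fderiv ℝ h q).det) :
    GaussMapEq z h.target (fun p => 2 * deriv F (psi θ c₁ c₂ (h.symm p)))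
      (σ • exteriorPower.map 2 A (modelC c₁ c₂)) := by
  have sθ (q) (hq : q ∈ h.source) : ContDiffAt ℝ ∞ θ q :=
    hθ.contDiffAt (h.open_source.mem_nhds hq)
  have hz (q) (hq : q ∈ h.source) := hL.contDiffAt_chart hhD hq
  have hh (q) (hq : q ∈ h.source) := hc.contDiffAt hq
  have hdet' (q) (hq : q ∈ h.source) : 0 < σ * (jac h q).det := by
    rw [← det_jac (dAt (hh q hq))]; exact hdet q hq
  constructor
  · have hψ : ContDiffOn ℝ ∞ (psi θ c₁ c₂) h.source := fun q hq =>
      (contDiffAt_psi (sθ q hq) c₁ c₂).contDiffWithinAt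
    have hdF : ContDiffOn ℝ ∞ (deriv F) J := ((contDiffOn_infty_iff_deriv_of_isOpen hJ).1 hF).2
    exact contDiffOn_const.mul ((hdF.comp hψ hmaps).comp hc.2.2.1 h.mapsTo_symm)
  · intro p hp
    obtain ⟨q, hq, rfl⟩ : ∃ q ∈ h.source, h q = p := ⟨h.symm p, h.map_target hp, h.right_inv hp⟩
    have hLq (i : Fin 2) : pd i (pd 0 (pd 1 θ)) q
        = deriv F (psi θ c₁ c₂ q) * (pd i θ q + ![c₁, c₂] i) := by
      have ev : pd 0 (pd 1 θ) =ᶠ[𝓝 q] fun q => F (psi θ c₁ c₂ q) := by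
        filter_upwards [h.open_source.mem_nhds hq] with q' hq'
        exact heq q' hq'
      have hFd : HasDerivAt F (deriv F (psi θ c₁ c₂ q)) (psi θ c₁ c₂ q) :=
        ((hF.contDiffAt (hJ.mem_nhds (hmaps hq))).differentiableAt (by simp)).hasDerivAt
      have hψ := dAt (contDiffAt_psi (sθ q hq) c₁ c₂)
      have hcomp : HasFDerivAt (fun q => F (psi θ c₁ c₂ q)) _ q :=
        hFd.comp_hasFDerivAt q hψ.hasFDerivAt
      rw [pd_congr ev, ← pd_psi (dAt (sθ q hq))]
      unfold pd
      rw [hcomp.fderiv]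
      rfl
    beta_reduce
    rw [laplacian_gaussMap_model h.open_source sθ hc.2.2.2 hc.1 hz hh hσ hdet' hq,
      gaussMap_model h.open_source sθ hc.2.2.2 hc.1 hz hh hσ hdet' hq, hLq, hLq, h.left_inv hq]
    simp only [modelC, map_sub, map_smul, map_wedge, Matrix.cons_val_zero, Matrix.cons_val_one]
    module

/-- Near a point where the Laplacian of the Gauss map is not zero, the defining function of a model
surface with pointwise 1-type Gauss map satisfies the model equation. -/
theorem exists_modelCondition {φ : Plane → ℝ} {C : Biv}
    (hC : ∀ p ∈ h.target, laplacian z (gaussMap z) p = φ p • (gaussMap z p + C))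
    {p : Plane} (hp : p ∈ h.target) (hne : laplacian z (gaussMap z) p ≠ 0) :
    ∃ V ⊆ h.source, IsOpen V ∧ h.symm p ∈ V ∧ ∃ F c₁ c₂, ModelCondition V θ F c₁ c₂ := by
  have sθ (q) (hq : q ∈ h.source) : ContDiffAt ℝ ∞ θ q :=
    hθ.contDiffAt (h.open_source.mem_nhds hq)
  have hz (q) (hq : q ∈ h.source) := hL.contDiffAt_chart hhD hq
  have hh (q) (hq : q ∈ h.source) := hc.contDiffAt hq
  have hx := hc.nullParam hL hhD hθ
  have hq₀ := h.map_target hp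
  set q₀ := h.symm p
  have hq₀p : h q₀ = p := h.right_inv hp
  obtain ⟨σ, hσ, S, hSh, hS, hqS, hdet⟩ := exists_orientation hx hz hh hq₀
  have sθ' (q) (hq : q ∈ S) := sθ q (hSh hq)
  have hz' (q) (hq : q ∈ S) := hz q (hSh hq)
  have hh' (q) (hq : q ∈ S) := hh q (hSh hq)
  have hc' (q) (hq : q ∈ S) := hc.2.2.2 q (hSh hq)
  have hσ2 : σ * σ = 1 := by rcases hσ with rfl | rfl <;> norm_num
  have hΔ (q) (hq : q ∈ S) := laplacian_gaussMap_model hS sθ' hc' hc.1 hz' hh' hσ hdet hq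
  obtain ⟨e, hee, he1, he2, h0e⟩ := exists_null_frame ip_eta11 ip_eta22 ip_eta12 ip_eta00
    ip_eta01 ip_eta02 eta0_ne_zero
  -- Pairing with `Ae ∧ Aη₁` extracts the coefficient of `Aη₀ ∧ Aη₂`, and pairing with `Ae ∧ Aη₂`
  -- that of `Aη₀ ∧ Aη₁`. In `G` the latter is `-σ θ_v`, hence the minus sign in `c₂`.
  let c₁ : ℝ := σ * pair (A e) (A eta1) C
  let c₂ : ℝ := -(σ * pair (A e) (A eta2) C)
  have key (q) (hq : q ∈ S) (i : Fin 2) : pd i (pd 0 (pd 1 θ)) q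
      = (φ (h q) / 2) * pd i (psi θ c₁ c₂) q := by
    have h1 := hC (h q) (h.map_source (hSh hq))
    rw [hΔ q hq, gaussMap_model hS sθ' hc' hc.1 hz' hh' hσ hdet hq] at h1
    have k0 := congrArg (pair (A e) (A eta1)) h1
    have k1 := congrArg (pair (A e) (A eta2)) h1
    simp only [map_smul, map_add, map_sub, pair_wedge, hc.1, smul_eq_mul, ip_eta01, ip_eta02,
      ip_eta11, ip_eta22, ip_eta12, h0e, ip_comm eta2 eta1, ip_comm eta1 e, ip_comm eta2 e, he1,
      he2] at k0 k1
    rw [pd_psi (dAt (sθ' q hq))]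
    fin_cases i
    · change pd 0 (pd 0 (pd 1 θ)) q = φ (h q) / 2 * (pd 0 θ q + c₁)
      simp only [c₁]
      linear_combination σ / 2 * k0 + (φ (h q) / 2 * pd 0 θ q - pd 0 (pd 0 (pd 1 θ)) q) * hσ2
    · change pd 1 (pd 0 (pd 1 θ)) q = φ (h q) / 2 * (pd 1 θ q + c₂)
      simp only [c₂]
      linear_combination -σ / 2 * k1 + (φ (h q) / 2 * pd 1 θ q - pd 1 (pd 0 (pd 1 θ)) q) * hσ2
  have hLne : pd 0 (pd 0 (pd 1 θ)) q₀ ≠ 0 ∨ pd 1 (pd 0 (pd 1 θ)) q₀ ≠ 0 := by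
    by_contra! h0
    apply hne
    rw [← hq₀p, hΔ q₀ hqS, h0.1, h0.2]
    simp
  have hψne : pd 0 (psi θ c₁ c₂) q₀ ≠ 0 ∨ pd 1 (psi θ c₁ c₂) q₀ ≠ 0 := by
    by_contra! h0
    rw [key q₀ hqS 0, key q₀ hqS 1, h0.1, h0.2] at hLne
    simp at hLne
  obtain ⟨V, hVS, hV, hqV, F, J, hJ, hF, hVJ⟩ := exists_comp_of_pd_eq
    (L := pd 0 (pd 1 θ)) (ψ := psi θ c₁ c₂) (κ := fun q => φ (h q) / 2) hS
    (fun q hq => contDiffAt_pd (contDiffAt_pd (sθ' q hq) 1) 0)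
    (fun q hq => contDiffAt_psi (sθ' q hq) c₁ c₂) key hqS hψne
  refine ⟨V, hVS.trans hSh, hV, hqV, F, c₁, c₂, hθ.mono (hVS.trans hSh),
    ⟨J, hJ, fun q hq => (hVJ q hq).1, hF⟩, ?_, fun q hq => (hVJ q hq).2⟩
  -- If `F` were constant on the values of `ψ`, then `θ_uv` would be constant near `q₀`, against the
  -- nonvanishing of its differential there.
  by_contra! h0
  have hz0 (i) : pd i (pd 0 (pd 1 θ)) q₀ = 0 := by
    rw [pd_congr (g := fun _ => F (psi θ c₁ c₂ q₀)), pd_const]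
    filter_upwards [hV.mem_nhds hqV] with q hq
    rw [(hVJ q hq).2]
    exact h0 q hq q₀ hqV
  simp [hz0] at hLne

theorem hasPointwiseOneType_of_congruent {F : ℝ → ℝ} {c₁ c₂ : ℝ}
    (hM : ModelCondition h.source θ F c₁ c₂) {p : Plane} (hp : p ∈ h.target)
    (hne : laplacian z (gaussMap z) p ≠ 0) :
    ∃ U : Set Plane, IsOpen U ∧ p ∈ U ∧ U ⊆ D ∧ HasPointwiseOneType z U := by
  obtain ⟨-, ⟨J, hJ, hmaps, hF⟩, -, heq⟩ := hM
  have hz (q) (hq : q ∈ h.source) := hL.contDiffAt_chart hhD hq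
  have hh (q) (hq : q ∈ h.source) := hc.contDiffAt hq
  have hx := hc.nullParam hL hhD hθ
  have hq₀ := h.map_target hp
  obtain ⟨σ, hσ, S, hSh, hS, hqS, hdet⟩ := exists_orientation hx hz hh hq₀
  let h' := h.restrOpen S hS
  have hp' : p ∈ h'.target := ⟨hp, hqS⟩
  have hsub : h'.source ⊆ h.source := fun q hq => hq.1
  have hG := gaussMapEq_of_congruent (h := h') hL (fun q hq => hhD hq.1) (hθ.mono hsub)
    (hc.restr hS) hJ (hmaps.mono_left hsub) hF (fun q hq => heq q (hsub hq)) hσ (fun q hq => by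
      have : (h' : Plane → Plane) = h := rfl
      rw [this, det_jac (dAt (hh q (hsub hq)))]
      exact hdet q hq.2)
  set φ : Plane → ℝ := fun p => 2 * deriv F (psi θ c₁ c₂ (h'.symm p))
  -- Only here is `ΔG(p) ≠ 0` needed: it forces `φ(p) ≠ 0`, and continuity gives a neighbourhood
  -- without zeros of `φ`.
  have hφp : φ p ≠ 0 := by
    intro h0
    apply hne
    rw [hG.2 p hp', h0, zero_smul]
  have hcont : ContinuousAt φ p :=
    hG.1.continuousOn.continuousAt (h'.open_target.mem_nhds hp')
  obtain ⟨U, hU, hUo, hpU⟩ := mem_nhds_iff.1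
    (inter_mem (h'.open_target.mem_nhds hp') (hcont.eventually_ne hφp))
  exact ⟨U, hUo, hpU, fun q hq => hhD (hU hq).1.1, φ, _,
    ⟨hG.1.mono fun q hq => (hU hq).1, fun q hq => hG.2 q (hU hq).1⟩, fun q hq => (hU hq).2⟩

end

end FlatQuasi

open FlatQuasi in
theorem theorem3p7 (z : Plane → E) (D : Set Plane)
    (hL : IsLorentzSurface z D) (hK : IsFlat z D) (hH : IsQuasiMinimal z D) :
    -- the form of the surface near every point, harmonic or not
    (∀ p ∈ D, (∃ U : Set Plane, IsOpen U ∧ p ∈ U ∧ U ⊆ D ∧ HasPointwiseOneType z U) →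
      ∃ (h : OpenPartialHomeomorph Plane Plane) (A : E →ₗ[ℝ] E) (w : E) (θ : Plane → ℝ),
        p ∈ h.target ∧ h.target ⊆ D ∧
        ContDiffOn ℝ ∞ θ h.source ∧ CongruentVia (model θ) z A w h) ∧
    -- the characterization at the points where the Laplacian of the Gauss map is not zero
    (∀ p ∈ D, laplacian z (gaussMap z) p ≠ 0 →
      ((∃ U : Set Plane, IsOpen U ∧ p ∈ U ∧ U ⊆ D ∧ HasPointwiseOneType z U) ↔
        ∃ (h : OpenPartialHomeomorph Plane Plane) (A : E →ₗ[ℝ] E) (w : E)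
          (θ : Plane → ℝ) (F : ℝ → ℝ) (c₁ c₂ : ℝ),
          p ∈ h.target ∧ h.target ⊆ D ∧
          ModelCondition h.source θ F c₁ c₂ ∧ CongruentVia (model θ) z A w h)) ∧
    -- the function and the constant bivector; `σ` records whether `h` preserves orientation
    (∀ (h : OpenPartialHomeomorph Plane Plane) (A : E →ₗ[ℝ] E) (w : E)
        (θ : Plane → ℝ) (F : ℝ → ℝ) (c₁ c₂ σ : ℝ),
        h.target ⊆ D → ModelCondition h.source θ F c₁ c₂ → CongruentVia (model θ) z A w h →
        (σ = 1 ∨ σ = -1) → (∀ q ∈ h.source, 0 < σ * (fderiv ℝ h q).det) →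
        modelC c₁ c₂ ≠ 0 ∧
        GaussMapEq z h.target (fun p => 2 * deriv F (psi θ c₁ c₂ (h.symm p)))
          (σ • exteriorPower.map 2 A (modelC c₁ c₂)) ∧
        ((∀ q ∈ h.source, deriv F (psi θ c₁ c₂ q) ≠ 0) → HasPointwiseOneType z h.target)) := by
  refine ⟨?_, ?_, ?_⟩
  · rintro p - ⟨U, hU, hpU, hUD, h1⟩
    obtain ⟨h, A, w, θ, hp, hhU, hθ, hc⟩ := exists_model hL hK hH hU hpU hUD h1
    exact ⟨h, A, w, θ, hp, hhU.trans hUD, hθ, hc⟩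
  · intro p _ hne
    constructor
    · rintro ⟨U, hU, hpU, hUD, h1⟩
      obtain ⟨h, A, w, θ, hp, hhU, hθ, hc⟩ := exists_model hL hK hH hU hpU hUD h1
      obtain ⟨φ, C, hG, -⟩ := h1
      obtain ⟨V, hVh, hV, hpV, F, c₁, c₂, hM⟩ := exists_modelCondition hL (hhU.trans hUD) hθ hc
        (fun q hq => hG.2 q (hhU hq)) hp hne
      refine ⟨h.restrOpen V hV, A, w, θ, F, c₁, c₂, ⟨hp, hpV⟩, fun q hq => hUD (hhU hq.1), ?_,
        hc.restr hV⟩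
      have hs : (h.restrOpen V hV).source = V := inter_eq_right.2 hVh
      rwa [hs]
    · rintro ⟨h, A, w, θ, F, c₁, c₂, hp, hhD, hM, hc⟩
      exact hasPointwiseOneType_of_congruent hL hhD hM.1 hc hM hp hne
  · intro h A w θ F c₁ c₂ σ hhD hM hc hσ hdet
    obtain ⟨J, hJ, hmaps, hF⟩ := hM.2.1
    have hG := gaussMapEq_of_congruent hL hhD hM.1 hc hJ hmaps hF hM.2.2.2 hσ hdet
    exact ⟨modelC_ne_zero c₁ c₂, hG, fun hF' => ⟨_, _, hG, fun p hp =>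
      mul_ne_zero two_ne_zero (hF' _ (h.map_target hp))⟩⟩
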